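/- Let $n\ge 1$ and equip $\mathbb R^n$ with the uniform norm $\|x\|=\max_i|x_i|$; distances, diameters and lengths of curves are measured in this norm. Let $\Omega\subset\mathbb R^n$ be an arbitrary domain (nonempty, open, connected), let $n<p<\infty$, $\alpha=\frac{p-n}{p-1}\in(0,1]$ and $\eta\ge 41$. For $x,y\in\Omega$ let $d_{\alpha,\Omega}(x,y)=\inf_\gamma\int_\gamma \operatorname{dist}(z,\partial\Omega)^{\alpha-1}\,ds(z)$, the infimum being over all rectifiable curves $\gamma\subset\Omega$ joining $x$ to $y$ (with $\operatorname{dist}(z,\emptyset)=\infty$). Let $\Omega_\alpha$ be the Cauchy completion of $\Omega$ in the metric $\delta_\alpha(x,y)=d_{\alpha,\Omega}(x,y)+\|x-y\|^\alpha$, and let the $\alpha$-boundary $\partial_\alpha\Omega$ be the boundary of $\Omega$ as a subset of $\Omega_\alpha$. For $\omega\in\Omega_\alpha$ let $\ell(\omega)\in\overline\Omega$ be the common limit in $\mathbb R^n$ of the sequences in $\Omega$ that converge to $\omega$ in $\Omega_\alpha$, and for $\omega_1,\omega_2\in\Omega_\alpha$ let $d_{\alpha,\overline\Omega}(\omega_1,\omega_2)=\lim_i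 d_{\alpha,\Omega}(x_i,y_i)$ for any sequences $x_i\to\omega_1$, $y_i\to\omega_2$ in $\Omega$. Let $L^1_p(\Omega)$ be the homogeneous Sobolev space of functions on $\Omega$ whose distributional gradient is in $L_p(\Omega)$, with seminorm $\|F\|_{L^1_p(\Omega)}=\|\nabla F\|_{L_p(\Omega)}$. A function $f:\partial_\alpha\Omega\to\mathbb R$ is the trace of a continuous $F\in L^1_p(\Omega)$ if for each $\omega\in\partial_\alpha\Omega$ one has $F(x)\to f(\omega)$ as $x\in\Omega$ tends to $\omega$ in $\Omega_\alpha$; the trace norm $\|f\|_{\mathrm{tr}}$ is the infimum of $\|F\|_{L^1_p(\Omega)}$ over all continuous $F\in L^1_p(\Omega)$ with trace $f$. A cube is a closed cube of positive side length with sides parallel to the coordinate axes, and $\eta Q$ is the dilation of $Q$ about its center $x_Q$ by the factor $\eta$. For a cube $Q\subset\Omega$, an element $\omega\in\partial_\alpha\Omega$ is called $(\alpha,Q)$-visible if (i) for each $y\in Q$ the semi-open segment $(\ell(\omega),y]$ lies in $\Omega$, and (ii) some sequence of points of $(\ell(\omega),x_Q]$ converges to $\omega$ in $\Omega_\alpha$.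 Then a function $f:\partial_\alpha\Omega\to\mathbb R$ is the trace of a continuous function $F\in L^1_p(\Omega)$ if and only if $f$ is continuous with respect to $d_{\alpha,\overline\Omega}$ and there is a constant $\lambda>0$ such that $$\sum_{i=1}^m\frac{|f(\omega_i^{(1)})-f(\omega_i^{(2)})|^p}{(\operatorname{diam}Q_i)^{p-n}}\le\lambda\qquad(*)$$ for every finite family $\{Q_i\}_{i=1}^m$ of pairwise disjoint cubes in $\Omega$ and every choice of $(\alpha,Q_i)$-visible elements $\omega_i^{(1)},\omega_i^{(2)}\in\partial_\alpha\Omega$ with $\ell(\omega_i^{(1)}),\ell(\omega_i^{(2)})\in(\eta Q_i)\cap\partial\Omega$. Moreover, there is a constant $C\ge 1$ depending only on $n$, $p$ and $\eta$ such that for every such $\Omega$ and every such trace $f$ $$C^{-1}\inf\lambda^{1/p}\le\|f\|_{\mathrm{tr}}\le C\inf\lambda^{1/p},$$ the infimum being over all $\lambda>0$ for which $(*)$ holds in all these cases. -/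

import Mathlib

open Set Filter Topology MeasureTheory UniformSpace
open scoped ENNReal

noncomputable section

/-! Throughout, `ℝⁿ` is `Fin n → ℝ` with the uniform norm `‖x‖ = max |x i|`; distances, diameters
and lengths of curves are measured in this norm. -/

/-- A domain in `ℝⁿ`: a nonempty connected open set. -/
structure SpaceDomain (n : ℕ) where
  /-- The underlying set. -/
  carrier : Set (Fin n → ℝ)
  isOpen : IsOpen carrier
  isConnected : IsConnected carrier

namespace SpaceDomain

variable {n : ℕ}

/-- `γ` on `[0, L]` is a rectifiable curve in `Ω` from `x` to `y`, parametrized by arc length. -/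
structure IsArcLengthCurve (Ω : SpaceDomain n) (x y : Fin n → ℝ) (L : ℝ)
    (γ : ℝ → Fin n → ℝ) : Prop where
  nonneg : 0 ≤ L
  unitSpeed : HasUnitSpeedOn γ (Icc 0 L)
  source : γ 0 = x
  target : γ L = y
  mapsTo : MapsTo γ (Icc 0 L) Ω.carrier

/-- The subhyperbolic length `∫_γ dist(z, ∂Ω)^(α - 1) ds(z)` of a curve `γ` of length `L`
parametrized by arc length (the distance to the empty set is `∞`). -/
def subhypLength (Ω : SpaceDomain n) (α : ℝ) (L : ℝ) (γ : ℝ → Fin n → ℝ) : ℝ≥0∞ :=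
  ∫⁻ s in Icc 0 L, (Metric.infEDist (γ s) (frontier Ω.carrier)) ^ (α - 1)

/-- The subhyperbolic distance `d_{α,Ω}` with values in `[0, ∞]`: the infimum of the subhyperbolic
lengths of the rectifiable curves in `Ω` that join `x` to `y`. -/
def subhypEDist (Ω : SpaceDomain n) (α : ℝ) (x y : Fin n → ℝ) : ℝ≥0∞ :=
  ⨅ (L : ℝ) (γ : ℝ → Fin n → ℝ) (_ : Ω.IsArcLengthCurve x y L γ), Ω.subhypLength α L γ

/-- The subhyperbolic metric `d_{α,Ω}` (its finiteness on `Ω` is `subhypEDist_ne_top` below). -/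
def subhypDist (Ω : SpaceDomain n) (α : ℝ) (x y : Fin n → ℝ) : ℝ :=
  (Ω.subhypEDist α x y).toReal

/-! ### The metric axioms for `d_{α,Ω}` -/

theorem subhypEDist_self (Ω : SpaceDomain n) (α : ℝ) {x : Fin n → ℝ} (hx : x ∈ Ω.carrier) :
    Ω.subhypEDist α x x = 0 := by
  have h : Ω.IsArcLengthCurve x x 0 (fun _ => x) :=
    ⟨le_rfl, hasConstantSpeedOnWith_of_subsingleton _ (by simp) 1, rfl, rfl, fun _ _ => hx⟩
  have h0 : Ω.subhypLength α 0 (fun _ => x) = 0 := by simp [subhypLength]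
  exact le_antisymm (h0 ▸ iInf₂_le_of_le 0 _ (iInf_le _ h)) bot_le

theorem IsArcLengthCurve.reverse {Ω : SpaceDomain n} {x y : Fin n → ℝ} {L : ℝ}
    {γ : ℝ → Fin n → ℝ} (h : Ω.IsArcLengthCurve x y L γ) :
    Ω.IsArcLengthCurve y x L (fun s => γ (L - s)) := by
  refine ⟨h.nonneg, ?_, by simpa using h.target, by simpa using h.source, fun s hs => ?_⟩
  · refine hasConstantSpeedOnWith_iff_ordered.2 fun a ha b hb hab => ?_
    have e : Icc 0 L ∩ Icc a b = Icc a b := inter_eq_right.2 (Icc_subset_Icc ha.1 hb.2)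
    have hb' : L - b ∈ Icc 0 L := ⟨by linarith [hb.2], by linarith [hb.1]⟩
    have ha' : L - a ∈ Icc 0 L := ⟨by linarith [ha.2], by linarith [ha.1]⟩
    have h1 := h.unitSpeed hb' ha'
    have e' : Icc 0 L ∩ Icc (L - b) (L - a) = Icc (L - b) (L - a) :=
      inter_eq_right.2 (Icc_subset_Icc (by linarith [hb.2]) (by linarith [ha.1]))
    rw [e'] at h1
    have h2 := eVariationOn.comp_eq_of_antitoneOn γ (t := Icc a b) (fun s => L - s)
      (fun _ _ _ _ h => sub_le_sub_left h L)
    rw [image_const_sub_Icc, h1] at h2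
    rw [e]
    refine Eq.trans h2 ?_
    congr 2
    ring
  · exact h.mapsTo ⟨by linarith [hs.2], by linarith [hs.1]⟩

theorem subhypLength_reverse (Ω : SpaceDomain n) (α L : ℝ) (γ : ℝ → Fin n → ℝ) :
    Ω.subhypLength α L (fun s => γ (L - s)) = Ω.subhypLength α L γ := by
  unfold subhypLength
  rw [← lintegral_indicator measurableSet_Icc, ← lintegral_indicator measurableSet_Icc,
    ← lintegral_sub_left_eq_self _ L]
  congr 1
  ext s
  by_cases hs : s ∈ Icc 0 L
  · have hs' : L - s ∈ Icc 0 L := ⟨by linarith [hs.2], by linarith [hs.1]⟩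
    rw [indicator_of_mem hs, indicator_of_mem hs']
    simp
  · rw [indicator_of_notMem hs, indicator_of_notMem]
    intro h
    exact hs ⟨by linarith [h.2], by linarith [h.1]⟩

theorem subhypEDist_comm_le (Ω : SpaceDomain n) (α : ℝ) (x y : Fin n → ℝ) :
    Ω.subhypEDist α x y ≤ Ω.subhypEDist α y x := by
  refine le_iInf₂ fun L γ => le_iInf fun h => ?_
  exact iInf₂_le_of_le L _ (iInf_le_of_le h.reverse (Ω.subhypLength_reverse α L γ).le)

theorem subhypEDist_comm (Ω : SpaceDomain n) (α : ℝ) (x y : Fin n → ℝ) :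
    Ω.subhypEDist α x y = Ω.subhypEDist α y x :=
  le_antisymm (Ω.subhypEDist_comm_le α x y) (Ω.subhypEDist_comm_le α y x)

theorem IsArcLengthCurve.concat {Ω : SpaceDomain n} {x y z : Fin n → ℝ} {L₁ L₂ : ℝ}
    {γ₁ γ₂ : ℝ → Fin n → ℝ} (h₁ : Ω.IsArcLengthCurve x y L₁ γ₁)
    (h₂ : Ω.IsArcLengthCurve y z L₂ γ₂) :
    Ω.IsArcLengthCurve x z (L₁ + L₂) (fun s => if s ≤ L₁ then γ₁ s else γ₂ (s - L₁)) := by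
  have hL₁ := h₁.nonneg
  have hL₂ := h₂.nonneg
  set γ : ℝ → Fin n → ℝ := fun s => if s ≤ L₁ then γ₁ s else γ₂ (s - L₁) with hγ
  have e₁ : ∀ s, s ≤ L₁ → γ s = γ₁ s := fun s hs => by simp [hγ, hs]
  have e₂ : ∀ s, L₁ ≤ s → γ s = γ₂ (s - L₁) := fun s hs => by
    rcases hs.eq_or_lt with rfl | hs
    · simp [hγ, h₁.target, h₂.source]
    · simp [hγ, not_le.2 hs]
  refine ⟨by linarith, ?_, ?_, ?_, ?_⟩
  · refine HasUnitSpeedOn.Icc_Icc (y := L₁) ?_ ?_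
    · intro a ha b hb
      rw [eVariationOn.congr (g := γ₁) (fun s hs => e₁ s hs.1.2)]
      exact h₁.unitSpeed ha hb
    · refine hasConstantSpeedOnWith_iff_ordered.2 fun a ha b hb hab => ?_
      have ha' : a - L₁ ∈ Icc 0 L₂ := ⟨by linarith [ha.1], by linarith [ha.2]⟩
      have hb' : b - L₁ ∈ Icc 0 L₂ := ⟨by linarith [hb.1], by linarith [hb.2]⟩
      rw [eVariationOn.congr (g := γ₂ ∘ fun s => s - L₁) (fun s hs => e₂ s hs.1.1),
        inter_eq_right.2 (Icc_subset_Icc ha.1 hb.2),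
        eVariationOn.comp_eq_of_monotoneOn γ₂ (fun s => s - L₁)
          (fun _ _ _ _ h => by simpa using h), image_sub_const_Icc]
      have h := h₂.unitSpeed ha' hb'
      rw [inter_eq_right.2 (Icc_subset_Icc ha'.1 hb'.2)] at h
      rw [h]
      congr 2
      ring
  · rw [e₁ 0 hL₁, h₁.source]
  · rw [e₂ _ (by linarith), add_sub_cancel_left, h₂.target]
  · intro s hs
    rcases le_total s L₁ with h | h
    · rw [e₁ s h]
      exact h₁.mapsTo ⟨hs.1, h⟩
    · rw [e₂ s h]
      exact h₂.mapsTo ⟨by linarith, by linarith [hs.2]⟩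

theorem subhypLength_concat_le (Ω : SpaceDomain n) (α : ℝ) {L₁ L₂ : ℝ}
    (hL₁ : 0 ≤ L₁) (hL₂ : 0 ≤ L₂) (γ₁ γ₂ : ℝ → Fin n → ℝ) :
    Ω.subhypLength α (L₁ + L₂) (fun s => if s ≤ L₁ then γ₁ s else γ₂ (s - L₁)) ≤
      Ω.subhypLength α L₁ γ₁ + Ω.subhypLength α L₂ γ₂ := by
  unfold subhypLength
  have hu : Icc 0 (L₁ + L₂) = Icc 0 L₁ ∪ Ioc L₁ (L₁ + L₂) :=
    (Icc_union_Ioc_eq_Icc hL₁ (by linarith)).symm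
  rw [hu]
  refine (lintegral_union_le _ _ _).trans (add_le_add (le_of_eq ?_) ?_)
  · refine setLIntegral_congr_fun measurableSet_Icc fun s hs => ?_
    simp [hs.2]
  · rw [← lintegral_indicator measurableSet_Icc, ← lintegral_indicator measurableSet_Ioc,
      ← lintegral_sub_right_eq_self (Set.indicator (Icc 0 L₂) _) L₁]
    refine lintegral_mono fun s => ?_
    by_cases hs : s ∈ Ioc L₁ (L₁ + L₂)
    · have hs' : s - L₁ ∈ Icc 0 L₂ := ⟨by linarith [hs.1], by linarith [hs.2]⟩
      rw [indicator_of_mem hs, indicator_of_mem hs']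
      simp [not_le.2 hs.1]
    · rw [indicator_of_notMem hs]
      exact bot_le

theorem subhypEDist_triangle (Ω : SpaceDomain n) (α : ℝ) (x y z : Fin n → ℝ) :
    Ω.subhypEDist α x z ≤ Ω.subhypEDist α x y + Ω.subhypEDist α y z := by
  conv_rhs => unfold subhypEDist
  simp only [ENNReal.iInf_add, ENNReal.add_iInf]
  refine le_iInf fun L₂ => le_iInf fun γ₂ => le_iInf fun h₂ => le_iInf fun L₁ => le_iInf fun γ₁ =>
    le_iInf fun h₁ => ?_
  exact iInf₂_le_of_le _ _ (iInf_le_of_le (h₁.concat h₂)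
    (Ω.subhypLength_concat_le α h₁.nonneg h₂.nonneg γ₁ γ₂))

theorem subhypEDist_ne_top (Ω : SpaceDomain n) {α : ℝ} (hα : α ≤ 1) {x y : Fin n → ℝ}
    (hx : x ∈ Ω.carrier) (hy : y ∈ Ω.carrier) : Ω.subhypEDist α x y ≠ ⊤ := by
  refine Ω.isConnected.isPreconnected.induction₂ (fun x y => Ω.subhypEDist α x y ≠ ⊤)
    (fun x hx => ?_) (fun x y z _ _ _ h h' => ?_) (fun x y _ _ h => ?_) hx hy
  · obtain ⟨ε, hε, hεΩ⟩ := Metric.isOpen_iff.1 Ω.isOpen x hx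
    refine mem_nhdsWithin_of_mem_nhds ?_
    filter_upwards [Metric.ball_mem_nhds x (half_pos hε)] with y hy
    rcases eq_or_ne y x with rfl | hne
    · simp [Ω.subhypEDist_self α hx]
    have hL : 0 < ‖y - x‖ := norm_pos_iff.2 (sub_ne_zero.2 hne)
    have hL' : ‖y - x‖ < ε / 2 := by simpa [dist_eq_norm] using hy
    set L := ‖y - x‖ with hLdef
    set γ : ℝ → Fin n → ℝ := fun s => x + (s / L) • (y - x) with hγ
    have hd : ∀ s ∈ Icc 0 L, dist (γ s) x < ε / 2 := fun s hs => by
      rw [dist_eq_norm, hγ]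
      simp only [add_sub_cancel_left, norm_smul, Real.norm_eq_abs, abs_div, abs_of_nonneg hs.1,
        abs_of_pos hL]
      rw [← hLdef, div_mul_cancel₀ _ hL.ne']
      linarith [hs.2]
    have hiso : Isometry γ := Isometry.of_dist_eq fun s t => by
      rw [dist_eq_norm, hγ, Real.dist_eq]
      simp only [add_sub_add_left_eq_sub, ← sub_smul, norm_smul, ← sub_div, Real.norm_eq_abs,
        abs_div, abs_of_pos hL]
      rw [← hLdef, div_mul_cancel₀ _ hL.ne']
    have hcurve : Ω.IsArcLengthCurve x y L γ := by
      refine ⟨hL.le, ?_, by simp [hγ], by simp [hγ, hL.ne'], fun s hs => hεΩ ?_⟩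
      · refine hasConstantSpeedOnWith_iff_ordered.2 fun a ha b hb hab => ?_
        rw [inter_eq_right.2 (Icc_subset_Icc ha.1 hb.2)]
        have h1 : eVariationOn γ (Icc a b) = eVariationOn (id : ℝ → ℝ) (Icc a b) := by
          simp only [eVariationOn, hiso.edist_eq, id]
        rw [h1]
        refine le_antisymm ?_ ?_ <;> simp
      · exact Metric.mem_ball.2 (by linarith [hd s hs])
    have hbound : ∀ s ∈ Icc 0 L,
        (Metric.infEDist (γ s) (frontier Ω.carrier)) ^ (α - 1) ≤
          (ENNReal.ofReal (ε / 2)) ^ (α - 1) := fun s hs => by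
      rw [← neg_sub, ENNReal.rpow_neg, ENNReal.rpow_neg]
      refine ENNReal.inv_le_inv.2 (ENNReal.rpow_le_rpow ?_ (by linarith))
      refine Metric.le_infEDist.2 fun w hw => ?_
      rw [edist_dist]
      refine ENNReal.ofReal_le_ofReal ?_
      by_contra! hlt
      have hw' : w ∈ Ω.carrier := hεΩ (Metric.mem_ball.2 (by
        have := dist_triangle w (γ s) x
        rw [dist_comm w (γ s)] at this
        linarith [hd s hs]))
      rw [Ω.isOpen.frontier_eq] at hw
      exact hw.2 hw'
    refine ne_top_of_le_ne_top ?_ (iInf₂_le_of_le L γ (iInf_le_of_le hcurve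
      (setLIntegral_mono' measurableSet_Icc hbound)))
    rw [setLIntegral_const]
    refine ENNReal.mul_ne_top (ENNReal.rpow_ne_top_of_ne_zero ?_ ENNReal.ofReal_ne_top) (by simp)
    simpa using hε
  · exact ne_top_of_le_ne_top (ENNReal.add_ne_top.2 ⟨h, h'⟩) (Ω.subhypEDist_triangle α x y z)
  · rwa [Ω.subhypEDist_comm]

/-! ### The completion of `Ω` in the metric `d_{α,Ω}(x, y) + ‖x - y‖ ^ α` -/

/-- The points of `Ω`, to be equipped with the metric `d_{α,Ω}(x, y) + ‖x - y‖ ^ α`. -/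
def Subhyp (Ω : SpaceDomain n) (_α : Ioc (0 : ℝ) 1) : Type :=
  ↥Ω.carrier

/-- A point of `Ω`, as a point of `ℝⁿ`. -/
def Subhyp.pt {Ω : SpaceDomain n} {α : Ioc (0 : ℝ) 1} (x : Ω.Subhyp α) : Fin n → ℝ :=
  Subtype.val x

theorem Subhyp.pt_mem {Ω : SpaceDomain n} {α : Ioc (0 : ℝ) 1} (x : Ω.Subhyp α) :
    x.pt ∈ Ω.carrier :=
  Subtype.property x

theorem Subhyp.subhypDist_triangle {Ω : SpaceDomain n} {α : Ioc (0 : ℝ) 1} (x y z : Ω.Subhyp α) :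
    Ω.subhypDist α x.pt z.pt ≤ Ω.subhypDist α x.pt y.pt + Ω.subhypDist α y.pt z.pt := by
  unfold subhypDist
  have h₁ := Ω.subhypEDist_ne_top α.2.2 x.pt_mem y.pt_mem
  have h₂ := Ω.subhypEDist_ne_top α.2.2 y.pt_mem z.pt_mem
  rw [← ENNReal.toReal_add h₁ h₂]
  exact ENNReal.toReal_mono (ENNReal.add_ne_top.2 ⟨h₁, h₂⟩) (Ω.subhypEDist_triangle _ _ _ _)

theorem subhypDist_comm (Ω : SpaceDomain n) (α : ℝ) (x y : Fin n → ℝ) :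
    Ω.subhypDist α x y = Ω.subhypDist α y x := by
  unfold subhypDist
  rw [subhypEDist_comm]

theorem subhypDist_nonneg (Ω : SpaceDomain n) (α : ℝ) (x y : Fin n → ℝ) :
    0 ≤ Ω.subhypDist α x y :=
  ENNReal.toReal_nonneg

/-- The metric `d_{α,Ω}(x, y) + ‖x - y‖ ^ α` on `Ω`. -/
instance (Ω : SpaceDomain n) (α : Ioc (0 : ℝ) 1) : MetricSpace (Ω.Subhyp α) where
  dist x y := Ω.subhypDist α x.pt y.pt + ‖x.pt - y.pt‖ ^ (α : ℝ)
  dist_self x := by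
    simp [subhypDist, Ω.subhypEDist_self α x.pt_mem, Real.zero_rpow α.2.1.ne']
  dist_comm x y := by rw [subhypDist_comm, norm_sub_rev]
  dist_triangle x y z := by
    have h₁ := Subhyp.subhypDist_triangle x y z
    have h₂ : ‖x.pt - z.pt‖ ^ (α : ℝ) ≤ ‖x.pt - y.pt‖ ^ (α : ℝ) + ‖y.pt - z.pt‖ ^ (α : ℝ) :=
      (Real.rpow_le_rpow (norm_nonneg _) (norm_sub_le_norm_sub_add_norm_sub _ _ _) α.2.1.le).trans
        (Real.rpow_add_le_add_rpow (norm_nonneg _) (norm_nonneg _) α.2.1.le α.2.2)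
    linarith
  eq_of_dist_eq_zero {x y} h := by
    have h₁ := Ω.subhypDist_nonneg α x.pt y.pt
    have h₂ := Real.rpow_nonneg (norm_nonneg (x.pt - y.pt)) α
    have h₃ : ‖x.pt - y.pt‖ ^ (α : ℝ) = 0 := by linarith
    rw [Real.rpow_eq_zero (norm_nonneg _) α.2.1.ne', norm_eq_zero, sub_eq_zero] at h₃
    exact Subtype.ext h₃

theorem Subhyp.dist_def {Ω : SpaceDomain n} {α : Ioc (0 : ℝ) 1} (x y : Ω.Subhyp α) :
    dist x y = Ω.subhypDist α x.pt y.pt + ‖x.pt - y.pt‖ ^ (α : ℝ) :=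
  rfl

theorem Subhyp.uniformContinuous_pt (Ω : SpaceDomain n) (α : Ioc (0 : ℝ) 1) :
    UniformContinuous (Subhyp.pt : Ω.Subhyp α → Fin n → ℝ) := by
  refine Metric.uniformContinuous_iff.2 fun ε hε =>
    ⟨ε ^ (α : ℝ), Real.rpow_pos_of_pos hε _, fun x y h => ?_⟩
  rw [Subhyp.dist_def] at h
  have h' : ‖x.pt - y.pt‖ ^ (α : ℝ) < ε ^ (α : ℝ) := by
    linarith [Ω.subhypDist_nonneg α x.pt y.pt]
  rw [dist_eq_norm]
  exact lt_of_not_ge fun hle => h'.not_ge (Real.rpow_le_rpow hε.le hle α.2.1.le)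

theorem Subhyp.uniformContinuous₂_subhypDist (Ω : SpaceDomain n) (α : Ioc (0 : ℝ) 1) :
    UniformContinuous₂ fun x y : Ω.Subhyp α => Ω.subhypDist α x.pt y.pt := by
  have key : ∀ x y : Ω.Subhyp α, Ω.subhypDist α x.pt y.pt ≤ dist x y := fun x y => by
    rw [Subhyp.dist_def]
    linarith [Real.rpow_nonneg (norm_nonneg (x.pt - y.pt)) α]
  refine Metric.uniformContinuous_iff.2 fun ε hε => ⟨ε / 2, half_pos hε, ?_⟩
  rintro ⟨a, b⟩ ⟨a', b'⟩ h
  obtain ⟨h₁, h₂⟩ := max_lt_iff.1 (Prod.dist_eq.symm.trans_lt h)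
  have ha := key a a'
  have hb := key b b'
  have t₁ := Subhyp.subhypDist_triangle a a' b
  have t₂ := Subhyp.subhypDist_triangle a' b' b
  have t₃ := Subhyp.subhypDist_triangle a' a b'
  have t₄ := Subhyp.subhypDist_triangle a b b'
  rw [Ω.subhypDist_comm α b'.pt b.pt] at t₂
  rw [Ω.subhypDist_comm α a'.pt a.pt] at t₃
  rw [Real.dist_eq]
  refine abs_lt.2 ⟨?_, ?_⟩ <;> simp only [Function.uncurry] at * <;> linarith

/-- The Cauchy completion `Ω_α` of `Ω` in the metric `d_{α,Ω}(x, y) + ‖x - y‖ ^ α`. -/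
abbrev SubhypCompletion (Ω : SpaceDomain n) (α : Ioc (0 : ℝ) 1) : Type :=
  Completion (Ω.Subhyp α)

/-- The `α`-boundary `∂_α Ω`: the boundary of `Ω` as a subset of its completion `Ω_α`. -/
def alphaBoundary (Ω : SpaceDomain n) (α : Ioc (0 : ℝ) 1) : Set (Ω.SubhypCompletion α) :=
  frontier (range ((↑) : Ω.Subhyp α → Ω.SubhypCompletion α))

/-- The limit `ℓ(ω)` in `ℝⁿ` of the Cauchy sequences that represent `ω ∈ Ω_α`: the continuous
extension to `Ω_α` of the inclusion of `Ω` in `ℝⁿ`. -/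
def limitPoint (Ω : SpaceDomain n) (α : Ioc (0 : ℝ) 1) : Ω.SubhypCompletion α → Fin n → ℝ :=
  Completion.extension (Subhyp.pt : Ω.Subhyp α → Fin n → ℝ)

/-- The extension of `d_{α,Ω}` by continuity to `Ω_α`: the limit of `d_{α,Ω}(x_i, y_i)` for
sequences `x_i → ω₁`, `y_i → ω₂`. -/
def closureDist (Ω : SpaceDomain n) (α : Ioc (0 : ℝ) 1) :
    Ω.SubhypCompletion α → Ω.SubhypCompletion α → ℝ :=
  Completion.extension₂ fun x y : Ω.Subhyp α => Ω.subhypDist α x.pt y.pt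

/-- Continuity of a function on `∂_α Ω` with respect to the completed subhyperbolic metric. -/
def IsSubhypContinuous (Ω : SpaceDomain n) (α : Ioc (0 : ℝ) 1) (f : Ω.alphaBoundary α → ℝ) :
    Prop :=
  ∀ ω : Ω.alphaBoundary α, ∀ ε > 0, ∃ δ > 0, ∀ ω' : Ω.alphaBoundary α,
    Ω.closureDist α ω ω' < δ → |f ω' - f ω| < ε

/-! ### Sobolev functions and their traces -/

/-- `g` is the distributional gradient of `F` on `Ω`. -/
def IsWeakGradient (Ω : SpaceDomain n) (F : (Fin n → ℝ) → ℝ) (g : (Fin n → ℝ) → Fin n → ℝ) :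
    Prop :=
  ∀ φ : (Fin n → ℝ) → ℝ, ContDiff ℝ (⊤ : ℕ∞) φ → HasCompactSupport φ → tsupport φ ⊆ Ω.carrier →
    ∀ i : Fin n, ∫ x in Ω.carrier, F x * fderiv ℝ φ x (Pi.single i 1) =
      -∫ x in Ω.carrier, g x i * φ x

/-- `F` is (on `Ω`) a continuous function of the homogeneous Sobolev space `L¹_p(Ω)` and `g ∈ L_p(Ω)`
is its distributional gradient. -/
structure IsSobolevWith (Ω : SpaceDomain n) (p : ℝ) (F : (Fin n → ℝ) → ℝ)
    (g : (Fin n → ℝ) → Fin n → ℝ) : Prop where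
  continuousOn : ContinuousOn F Ω.carrier
  isWeakGradient : Ω.IsWeakGradient F g
  memLp : MemLp g (ENNReal.ofReal p) (volume.restrict Ω.carrier)

/-- `f` is the trace of `F` to `∂_α Ω`: `f(ω)` is the limit of `F(x)` as `x ∈ Ω` tends to `ω`
in `Ω_α`. -/
def IsTrace (Ω : SpaceDomain n) (α : Ioc (0 : ℝ) 1) (F : (Fin n → ℝ) → ℝ)
    (f : Ω.alphaBoundary α → ℝ) : Prop :=
  ∀ ω : Ω.alphaBoundary α, Tendsto (fun x : Ω.Subhyp α => F x.pt)
    (comap ((↑) : Ω.Subhyp α → Ω.SubhypCompletion α) (𝓝 (ω : Ω.SubhypCompletion α))) (𝓝 (f ω))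

/-- `f` is the trace of a continuous function of `L¹_p(Ω)`. -/
def IsSobolevTrace (Ω : SpaceDomain n) (p : ℝ) (α : Ioc (0 : ℝ) 1)
    (f : Ω.alphaBoundary α → ℝ) : Prop :=
  ∃ F g, Ω.IsSobolevWith p F g ∧ Ω.IsTrace α F f

/-- The trace norm: the infimum of `‖∇F‖_{L_p(Ω)}` over the continuous `F ∈ L¹_p(Ω)` with
trace `f`. -/
def traceNorm (Ω : SpaceDomain n) (p : ℝ) (α : Ioc (0 : ℝ) 1) (f : Ω.alphaBoundary α → ℝ) : ℝ :=
  sInf {N : ℝ | ∃ F g, Ω.IsSobolevWith p F g ∧ Ω.IsTrace α F f ∧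
    N = (eLpNorm g (ENNReal.ofReal p) (volume.restrict Ω.carrier)).toReal}

end SpaceDomain

/-! ### Cubes and visibility -/

/-- A closed cube `Q(x, r)` with sides parallel to the axes, of positive side length `2r`. -/
structure AxisCube (n : ℕ) where
  /-- The center of the cube. -/
  center : Fin n → ℝ
  /-- Half of the side length. -/
  radius : ℝ
  radius_pos : 0 < radius

namespace AxisCube

variable {n : ℕ}

/-- The dilation `ηQ` of `Q` about its center. -/
def dilate (Q : AxisCube n) (η : ℝ) : Set (Fin n → ℝ) :=
  Metric.closedBall Q.center (η * Q.radius)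

/-- The points of the cube `Q`. -/
def toSet (Q : AxisCube n) : Set (Fin n → ℝ) :=
  Metric.closedBall Q.center Q.radius

end AxisCube

namespace SpaceDomain

variable {n : ℕ}

/-- The point `x` of the closure of `Ω` is `Q`-visible in `Ω`: for every `y ∈ Q` the semi-open
segment `(x, y]` lies in `Ω`. -/
def IsVisible (Ω : SpaceDomain n) (Q : AxisCube n) (x : Fin n → ℝ) : Prop :=
  x ∈ closure Ω.carrier ∧ ∀ y ∈ Q.toSet, AffineMap.lineMap x y '' Ioc (0 : ℝ) 1 ⊆ Ω.carrier

/-- `ω` is `(α, Q)`-visible in `Ω`: the point `ℓ(ω)` is `Q`-visible, and `ω` is represented by a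
sequence of points of the semi-open segment from `ℓ(ω)` to the center of `Q`. -/
def IsAlphaVisible (Ω : SpaceDomain n) (α : Ioc (0 : ℝ) 1) (Q : AxisCube n)
    (ω : Ω.SubhypCompletion α) : Prop :=
  Ω.IsVisible Q (Ω.limitPoint α ω) ∧
    ∃ y : ℕ → Ω.Subhyp α,
      (∀ i, (y i).pt ∈ AffineMap.lineMap (Ω.limitPoint α ω) Q.center '' Ioc (0 : ℝ) 1) ∧
      Tendsto (fun i => (y i : Ω.SubhypCompletion α)) atTop (𝓝 ω)

/-- The variational inequality with constant `lam`, for all finite families of pairwise disjoint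
cubes in `Ω` and all choices of visible boundary elements over the dilated cubes. -/
def VariationBound (Ω : SpaceDomain n) (p : ℝ) (α : Ioc (0 : ℝ) 1) (η : ℝ)
    (f : Ω.alphaBoundary α → ℝ) (lam : ℝ) : Prop :=
  ∀ (m : ℕ) (Q : Fin m → AxisCube n) (ω₁ ω₂ : Fin m → Ω.alphaBoundary α),
    (∀ i, (Q i).toSet ⊆ Ω.carrier) →
    (Pairwise fun i j => Disjoint (Q i).toSet (Q j).toSet) →
    (∀ i, Ω.IsAlphaVisible α (Q i) (ω₁ i) ∧ Ω.IsAlphaVisible α (Q i) (ω₂ i)) →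
    (∀ i, Ω.limitPoint α (ω₁ i) ∈ (Q i).dilate η ∩ frontier Ω.carrier ∧
      Ω.limitPoint α (ω₂ i) ∈ (Q i).dilate η ∩ frontier Ω.carrier) →
    ∑ i, |f (ω₁ i) - f (ω₂ i)| ^ p / Metric.diam (Q i).toSet ^ (p - n) ≤ lam

end SpaceDomain

end

/-!
Necessity. If `ω` is visible from a cube `Q` of half side length `r`, then `Ω` contains the cone
with apex `ℓ(ω)` over `Q`. Along points of the axis that approach the apex geometrically, at
distance of order `t ^ k * r`, Morrey's inequality bounds the increments of `F` by `(t ^ k * r) ^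
(p - n) * ∫_{B_k} ‖∇F‖ ^ p`, with `B_k` a ball of radius of order `t ^ k * r` about the axis. For
fixed `k` the balls that belong to disjoint cubes have bounded overlap, because the cube of such a
ball has size comparable to the distance from the ball to the boundary divided by `t ^ k`; since
`p > n` the sum over `k` is a geometric series.

Sufficiency. For each point `j` of a Whitney net of `Ω`, the segment from `j` to a nearest
boundary point ends at an element `ω_j` of the `α`-boundary, visible from every cube in the
largest ball in `Ω` about `j`. Glue the values `f(ω_j)` by a Whitney partition of unity. At the
scale of the net the gradient of the extension is a difference of such values divided by the
distance to the boundary, so its energy is a sum of the kind bounded by the variational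
inequality, for the disjoint cubes about the points of the net.
-/

noncomputable section

theorem one_div_natCast_add_one_mem_Ioc (k : ℕ) : 1 / ((k : ℝ) + 1) ∈ Ioc (0 : ℝ) 1 :=
  ⟨by positivity, (div_le_one (by positivity)).2 (by simp)⟩

theorem ennreal_rpow_le_rpow_of_nonpos {x y : ℝ≥0∞} (hxy : x ≤ y) {q : ℝ} (hq : q ≤ 0) :
    y ^ q ≤ x ^ q := by
  have h := ENNReal.inv_le_inv.2 (ENNReal.rpow_le_rpow hxy (neg_nonneg.2 hq))
  simpa only [ENNReal.rpow_neg, inv_inv] using h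

theorem lintegral_rpow_Ioc {q u : ℝ} (hq : -1 < q) (hu : 0 ≤ u) :
    ∫⁻ t in Ioc 0 u, ENNReal.ofReal (t ^ q) = ENNReal.ofReal (u ^ (q + 1) / (q + 1)) := by
  have hint : IntegrableOn (fun t : ℝ => t ^ q) (Ioc 0 u) :=
    (intervalIntegrable_iff_integrableOn_Ioc_of_le hu).1
      (intervalIntegral.intervalIntegrable_rpow' hq)
  rw [← ofReal_integral_eq_lintegral_ofReal hint ((ae_restrict_mem measurableSet_Ioc).mono
      fun t ht => Real.rpow_nonneg ht.1.le _),
    ← intervalIntegral.integral_of_le hu, integral_rpow (Or.inl hq),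
    Real.zero_rpow (by linarith), sub_zero]

theorem hasUnitSpeedOn_of_isometry {E : Type*} [PseudoEMetricSpace E] {γ : ℝ → E}
    (hγ : Isometry γ) (a b : ℝ) : HasUnitSpeedOn γ (Icc a b) := by
  refine hasConstantSpeedOnWith_iff_ordered.2 fun s hs t ht _ => ?_
  have hid : eVariationOn γ (Icc s t) = eVariationOn (id : ℝ → ℝ) (Icc s t) := by
    simp only [eVariationOn, hγ.edist_eq, id]
  rw [inter_eq_right.2 (Icc_subset_Icc hs.1 ht.2), hid]
  refine le_antisymm ?_ ?_ <;> simp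

theorem edist_le_of_hasUnitSpeedOn {E : Type*} [PseudoEMetricSpace E] {γ : ℝ → E} {a b s t : ℝ}
    (hγ : HasUnitSpeedOn γ (Icc a b)) (hs : s ∈ Icc a b) (ht : t ∈ Icc a b) (hst : s ≤ t) :
    edist (γ s) (γ t) ≤ ENNReal.ofReal (t - s) := by
  have hvar := eVariationOn.edist_le γ (s := Icc a b ∩ Icc s t)
    ⟨hs, left_mem_Icc.2 hst⟩ ⟨ht, right_mem_Icc.2 hst⟩
  simpa [hγ hs ht] using hvar

theorem dist_lineMap_lineMap_same_param {E : Type*} [NormedAddCommGroup E] [NormedSpace ℝ E]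
    (a x y : E) (u : ℝ) :
    dist (AffineMap.lineMap a x u) (AffineMap.lineMap a y u) = |u| * dist x y := by
  simp only [AffineMap.lineMap_apply, vsub_eq_sub, vadd_eq_add, dist_add_right, dist_smul₀,
    dist_sub_right, Real.norm_eq_abs]

theorem tendsto_of_dist_le_mul_rpow {X ι : Type*} [PseudoMetricSpace X] {l : Filter ι} {f : ι → X}
    {x : X} {t : ι → ℝ} {C q : ℝ} (hq : 0 < q) (ht : Tendsto t l (𝓝 0))
    (h : ∀ i, dist (f i) x ≤ C * t i ^ q) : Tendsto f l (𝓝 x) := by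
  have hlim := (ht.rpow_const (p := q) (Or.inr hq.le)).const_mul C
  rw [Real.zero_rpow hq.ne', mul_zero] at hlim
  exact tendsto_iff_dist_tendsto_zero.2 (squeeze_zero (fun _ => dist_nonneg) h hlim)

/-! ### Morrey's inequality -/

theorem lintegral_mul_le_lintegral_rpow_mul {X : Type*} [MeasurableSpace X] (μ : Measure X) {p : ℝ}
    (hp : 1 ≤ p) {h w : X → ℝ≥0∞} (hh : AEMeasurable h μ) (hw : AEMeasurable w μ) :
    ∫⁻ x, h x * w x ∂μ ≤ (∫⁻ x, h x ^ p * w x ∂μ) ^ (1 / p) * (∫⁻ x, w x ∂μ) ^ (1 - 1 / p) := by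
  have hp0 : 0 < p := by linarith
  have hp1 : 0 ≤ 1 - 1 / p := sub_nonneg.2 ((div_le_one hp0).2 hp)
  refine le_trans (le_of_eq (lintegral_congr fun x => ?_)) (ENNReal.lintegral_mul_norm_pow_le
    (f := fun x => h x ^ p * w x) (g := w) ((hh.pow_const p).mul hw) hw (by positivity) hp1
    (by ring))
  rw [ENNReal.mul_rpow_of_nonneg _ _ (by positivity), ← ENNReal.rpow_mul,
    mul_one_div_cancel hp0.ne', ENNReal.rpow_one, mul_assoc,
    ← ENNReal.rpow_add_of_nonneg _ _ (by positivity) hp1, add_sub_cancel, ENNReal.rpow_one]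

section Morrey

variable {E F : Type*} [NormedAddCommGroup E] [NormedSpace ℝ E] [NormedAddCommGroup F]
  [NormedSpace ℝ F]

theorem enorm_sub_le_lintegral_fderiv [CompleteSpace F] {G : E → F} (hG : ContDiff ℝ 1 G)
    (x y : E) :
    ‖G y - G x‖ₑ ≤ ‖y - x‖ₑ * ∫⁻ t in Ioc (0 : ℝ) 1, ‖fderiv ℝ G (AffineMap.lineMap x y t)‖ₑ := by
  have hcont : Continuous fun t : ℝ => fderiv ℝ G (AffineMap.lineMap x y t) :=
    (hG.continuous_fderiv one_ne_zero).comp AffineMap.lineMap_continuous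
  have hderiv : ∀ t ∈ uIcc (0 : ℝ) 1, HasDerivAt (fun t : ℝ => G (AffineMap.lineMap x y t))
      (fderiv ℝ G (AffineMap.lineMap x y t) (y - x)) t := fun t _ =>
    (hG.differentiable one_ne_zero _).hasFDerivAt.comp_hasDerivAt t AffineMap.hasDerivAt_lineMap
  have hftc := intervalIntegral.integral_eq_sub_of_hasDerivAt hderiv
    ((hcont.clm_apply continuous_const).intervalIntegrable 0 1)
  rw [AffineMap.lineMap_apply_one, AffineMap.lineMap_apply_zero,
    intervalIntegral.integral_of_le zero_le_one] at hftc
  rw [← hftc, mul_comm, ← lintegral_mul_const' _ _ enorm_ne_top]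
  exact (enorm_integral_le_lintegral_enorm _).trans
    (lintegral_mono fun t => ContinuousLinearMap.le_opENorm _ _)

variable [FiniteDimensional ℝ E] [MeasurableSpace E] [BorelSpace E] {μ : Measure E}
  [μ.IsAddHaarMeasure] {B : Set E} {x : E}

theorem setLIntegral_comp_lineMap_le (hB : Convex ℝ B) (hBm : MeasurableSet B) (hx : x ∈ B)
    {H : E → ℝ≥0∞} (hH : Measurable H) {t : ℝ} (ht : t ∈ Ioc (0 : ℝ) 1) :
    ∫⁻ y in B, H (AffineMap.lineMap x y t) ∂μ ≤
      ENNReal.ofReal (t ^ (-(Module.finrank ℝ E : ℝ))) * ∫⁻ y in B, H y ∂μ := by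
  have : Measurable (B.indicator H) := hH.indicator hBm
  have hpow : t ^ (-(Module.finrank ℝ E : ℝ)) = |(t ^ Module.finrank ℝ E)⁻¹| := by
    rw [Real.rpow_neg ht.1.le, Real.rpow_natCast, abs_of_pos (inv_pos.2 (pow_pos ht.1 _))]
  rw [← lintegral_indicator hBm, ← lintegral_indicator hBm]
  calc ∫⁻ y, B.indicator (fun y => H (AffineMap.lineMap x y t)) y ∂μ
      ≤ ∫⁻ y, B.indicator H (t • (y - x) + x) ∂μ := by
        refine lintegral_mono fun y => ?_
        by_cases hy : y ∈ B
        · have hmem : t • (y - x) + x ∈ B := hB.lineMap_mem hx hy ⟨ht.1.le, ht.2⟩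
          rw [indicator_of_mem hy, indicator_of_mem hmem]
          rfl
        · rw [indicator_of_notMem hy]
          exact bot_le
    _ = ∫⁻ y, B.indicator H (t • y + x) ∂μ :=
        lintegral_sub_right_eq_self (fun y => B.indicator H (t • y + x)) x
    _ = ∫⁻ y, B.indicator H (y + x) ∂(Measure.map (fun y : E => t • y) μ) :=
        (lintegral_map (f := fun y => B.indicator H (y + x)) (by fun_prop) (by fun_prop)).symm
    _ = _ := by
        rw [Measure.map_addHaar_smul _ ht.1.ne', lintegral_smul_measure,
          lintegral_add_right_eq_self, smul_eq_mul, hpow]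

theorem setLIntegral_comp_lineMap_le_rpow {p : ℝ} (hp : 1 ≤ p) (hB : Convex ℝ B)
    (hBm : MeasurableSet B) (hx : x ∈ B) {H : E → ℝ≥0∞} (hH : Measurable H) {t : ℝ}
    (ht : t ∈ Ioc (0 : ℝ) 1) :
    ∫⁻ y in B, H (AffineMap.lineMap x y t) ∂μ ≤
      μ B ^ (1 - 1 / p) * (∫⁻ y in B, H y ^ p ∂μ) ^ (1 / p) *
        ENNReal.ofReal (t ^ (-(Module.finrank ℝ E / p) : ℝ)) := by
  have hp0 : 0 ≤ 1 / p := by positivity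
  have hm : Measurable fun y => H (AffineMap.lineMap x y t) := by
    refine hH.comp ?_
    simp only [AffineMap.lineMap_apply]
    fun_prop
  have hholder := lintegral_mul_le_lintegral_rpow_mul (μ.restrict B) hp hm.aemeasurable
    (aemeasurable_const (b := (1 : ℝ≥0∞)))
  simp only [mul_one, lintegral_const, one_mul, Measure.restrict_apply_univ] at hholder
  have hexp : (t ^ (-(Module.finrank ℝ E : ℝ))) ^ (1 / p) = t ^ (-(Module.finrank ℝ E / p)) := by
    rw [← Real.rpow_mul ht.1.le]
    ring_nf
  calc ∫⁻ y in B, H (AffineMap.lineMap x y t) ∂μ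
      ≤ (∫⁻ y in B, H (AffineMap.lineMap x y t) ^ p ∂μ) ^ (1 / p) * μ B ^ (1 - 1 / p) := hholder
    _ ≤ (ENNReal.ofReal (t ^ (-(Module.finrank ℝ E : ℝ))) * ∫⁻ y in B, H y ^ p ∂μ) ^ (1 / p) *
          μ B ^ (1 - 1 / p) := by
        gcongr
        exact setLIntegral_comp_lineMap_le hB hBm hx (hH.pow_const p) ht
    _ = _ := by
        rw [ENNReal.mul_rpow_of_nonneg _ _ hp0,
          ENNReal.ofReal_rpow_of_pos (Real.rpow_pos_of_pos ht.1 _), hexp]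
        ring

variable [CompleteSpace F] {p : ℝ} {G : E → F}

theorem setLIntegral_enorm_sub_le (hp1 : 1 ≤ p) (hp : (Module.finrank ℝ E : ℝ) < p)
    (hG : ContDiff ℝ 1 G) (hB : Convex ℝ B) (hBm : MeasurableSet B) (hx : x ∈ B) :
    ∫⁻ y in B, ‖G y - G x‖ₑ ∂μ ≤
      Metric.ediam B * (μ B ^ (1 - 1 / p) * (∫⁻ y in B, ‖fderiv ℝ G y‖ₑ ^ p ∂μ) ^ (1 / p) *
        ENNReal.ofReal (1 / (1 - Module.finrank ℝ E / p))) := by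
  have hp0 : 0 < p := by linarith
  have hline : Continuous fun q : E × ℝ => (AffineMap.lineMap x q.1 q.2 : E) := by
    simp only [AffineMap.lineMap_apply]
    fun_prop
  have hfderiv : Measurable fun y => ‖fderiv ℝ G y‖ₑ :=
    (hG.continuous_fderiv one_ne_zero).enorm.measurable
  have hm : Measurable fun q : E × ℝ => ‖fderiv ℝ G (AffineMap.lineMap x q.1 q.2)‖ₑ :=
    hfderiv.comp hline.measurable
  calc ∫⁻ y in B, ‖G y - G x‖ₑ ∂μ
      ≤ ∫⁻ y in B, Metric.ediam B *
          (∫⁻ t in Ioc (0 : ℝ) 1, ‖fderiv ℝ G (AffineMap.lineMap x y t)‖ₑ) ∂μ :=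
        setLIntegral_mono' hBm fun y hy => (enorm_sub_le_lintegral_fderiv hG x y).trans <| by
          gcongr
          exact edist_eq_enorm_sub y x ▸ Metric.edist_le_ediam_of_mem hy hx
    _ = Metric.ediam B * ∫⁻ t in Ioc (0 : ℝ) 1,
          ∫⁻ y in B, ‖fderiv ℝ G (AffineMap.lineMap x y t)‖ₑ ∂μ := by
        rw [lintegral_const_mul _ hm.lintegral_prod_right',
          lintegral_lintegral_swap hm.aemeasurable]
    _ ≤ Metric.ediam B * ∫⁻ t in Ioc (0 : ℝ) 1, μ B ^ (1 - 1 / p) *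
          (∫⁻ y in B, ‖fderiv ℝ G y‖ₑ ^ p ∂μ) ^ (1 / p) *
            ENNReal.ofReal (t ^ (-(Module.finrank ℝ E / p) : ℝ)) := by
        exact mul_le_mul_right (setLIntegral_mono' measurableSet_Ioc fun t ht =>
          setLIntegral_comp_lineMap_le_rpow hp1 hB hBm hx hfderiv ht) _
    _ = _ := by
        rw [lintegral_const_mul _ (by fun_prop), lintegral_rpow_Ioc
          (neg_lt_neg ((div_lt_one hp0).2 hp)) zero_le_one, Real.one_rpow, neg_add_eq_sub]

theorem enorm_sub_mul_measure_le (hp1 : 1 ≤ p) (hp : (Module.finrank ℝ E : ℝ) < p)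
    (hG : ContDiff ℝ 1 G) (hB : Convex ℝ B) (hBm : MeasurableSet B) (hx : x ∈ B) {x' : E}
    (hx' : x' ∈ B) :
    ‖G x - G x'‖ₑ * μ B ≤
      2 * (Metric.ediam B * (μ B ^ (1 - 1 / p) *
        (∫⁻ y in B, ‖fderiv ℝ G y‖ₑ ^ p ∂μ) ^ (1 / p) *
          ENNReal.ofReal (1 / (1 - Module.finrank ℝ E / p)))) :=
  calc ‖G x - G x'‖ₑ * μ B = ∫⁻ _ in B, ‖G x - G x'‖ₑ ∂μ := (setLIntegral_const ..).symm
    _ ≤ ∫⁻ y in B, (‖G y - G x‖ₑ + ‖G y - G x'‖ₑ) ∂μ := by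
        refine lintegral_mono fun y => ?_
        simp only [← edist_eq_enorm_sub]
        exact edist_triangle_left _ _ _
    _ = (∫⁻ y in B, ‖G y - G x‖ₑ ∂μ) + ∫⁻ y in B, ‖G y - G x'‖ₑ ∂μ :=
        lintegral_add_left (hG.continuous.sub continuous_const).enorm.measurable _
    _ ≤ _ := (add_le_add (setLIntegral_enorm_sub_le hp1 hp hG hB hBm hx)
        (setLIntegral_enorm_sub_le hp1 hp hG hB hBm hx')).trans_eq (two_mul _).symm

theorem enorm_sub_rpow_le_of_contDiff (hp1 : 1 ≤ p) (hp : (Module.finrank ℝ E : ℝ) < p)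
    (hG : ContDiff ℝ 1 G) (hB : Convex ℝ B) (hBm : MeasurableSet B) (hB0 : μ B ≠ 0)
    (hBtop : μ B ≠ ⊤) (hx : x ∈ B) {x' : E} (hx' : x' ∈ B) :
    ‖G x - G x'‖ₑ ^ p ≤
      (2 * (Metric.ediam B * ENNReal.ofReal (1 / (1 - Module.finrank ℝ E / p)))) ^ p * (μ B)⁻¹ *
        ∫⁻ y in B, ‖fderiv ℝ G y‖ₑ ^ p ∂μ := by
  have hp0 : 0 < p := by linarith
  have hmul := enorm_sub_mul_measure_le (μ := μ) hp1 hp hG hB hBm hx hx'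
  rw [← ENNReal.le_div_iff_mul_le (Or.inl hB0) (Or.inl hBtop)] at hmul
  have hmeasure : (μ B ^ (1 - 1 / p) / μ B) ^ p = (μ B)⁻¹ := by
    rw [div_eq_mul_inv, ← ENNReal.rpow_neg_one, ← ENNReal.rpow_add _ _ hB0 hBtop,
      ← ENNReal.rpow_mul]
    congr 1
    field_simp
    ring
  calc _ ≤ _ := ENNReal.rpow_le_rpow hmul hp0.le
    _ = ((2 * (Metric.ediam B * ENNReal.ofReal (1 / (1 - Module.finrank ℝ E / p)))) *
          (μ B ^ (1 - 1 / p) / μ B) * (∫⁻ y in B, ‖fderiv ℝ G y‖ₑ ^ p ∂μ) ^ (1 / p)) ^ p := by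
        simp only [div_eq_mul_inv]
        ring_nf
    _ = _ := by
        rw [ENNReal.mul_rpow_of_nonneg _ _ hp0.le, ENNReal.mul_rpow_of_nonneg _ _ hp0.le, hmeasure,
          ← ENNReal.rpow_mul, one_div_mul_cancel hp0.ne', ENNReal.rpow_one]

end Morrey

/-- The constant in Morrey's inequality `|G x - G x'| ^ p ≤ C * s ^ (p - n) * ∫ ‖∇G‖ ^ p` on cubes
of `ℝⁿ` of side length `2 * s`. -/
def morreyConst (n : ℕ) (p : ℝ) : ℝ :=
  (4 * (1 / (1 - n / p))) ^ p / 2 ^ n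

theorem morreyConst_nonneg {n : ℕ} {p : ℝ} (hp : (n : ℝ) < p) : 0 ≤ morreyConst n p := by
  have hp0 : 0 < p := n.cast_nonneg.trans_lt hp
  have hK : 0 < 1 - n / p := sub_pos.2 ((div_lt_one hp0).2 hp)
  unfold morreyConst
  positivity

theorem enorm_sub_rpow_le_of_mem_closedBall {n : ℕ} {p : ℝ} (hp1 : 1 ≤ p) (hp : (n : ℝ) < p)
    {G : (Fin n → ℝ) → ℝ} (hG : ContDiff ℝ 1 G) {c x x' : Fin n → ℝ} {s : ℝ} (hs : 0 < s)
    (hx : x ∈ Metric.closedBall c s) (hx' : x' ∈ Metric.closedBall c s) :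
    ‖G x - G x'‖ₑ ^ p ≤ ENNReal.ofReal (morreyConst n p * s ^ (p - n)) *
      ∫⁻ y in Metric.closedBall c s, ‖fderiv ℝ G y‖ₑ ^ p := by
  have hp0 : 0 < p := by linarith
  have hK : 0 < 1 - n / p := sub_pos.2 ((div_lt_one hp0).2 hp)
  have hvol : volume (Metric.closedBall c s) = ENNReal.ofReal ((2 * s) ^ n) := by
    rw [Real.volume_pi_closedBall c hs.le, Fintype.card_fin]
  have hdiam : Metric.ediam (Metric.closedBall c s) ≤ ENNReal.ofReal (2 * s) := by
    rw [← Metric.closedEBall_ofReal hs.le, ENNReal.ofReal_mul zero_le_two, ENNReal.ofReal_ofNat]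
    exact Metric.ediam_closedEBall_le
  have hconst : (2 * (ENNReal.ofReal (2 * s) * ENNReal.ofReal (1 / (1 - n / p)))) ^ p *
      (ENNReal.ofReal ((2 * s) ^ n))⁻¹ = ENNReal.ofReal (morreyConst n p * s ^ (p - n)) := by
    rw [← ENNReal.ofReal_mul (by positivity), ← ENNReal.ofReal_ofNat 2,
      ← ENNReal.ofReal_mul (by positivity), ENNReal.ofReal_rpow_of_pos (by positivity),
      ← ENNReal.ofReal_inv_of_pos (by positivity), ← ENNReal.ofReal_mul (by positivity)]
    congr 1
    rw [morreyConst, mul_pow, Real.rpow_sub hs, Real.rpow_natCast,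
      show 2 * (2 * s * (1 / (1 - n / p))) = 4 * (1 / (1 - n / p)) * s by ring,
      Real.mul_rpow (by positivity) hs.le]
    field_simp
  have hmorrey := enorm_sub_rpow_le_of_contDiff (μ := volume) hp1
    (by rwa [Module.finrank_fin_fun]) hG (convex_closedBall c s) measurableSet_closedBall
    (Metric.measure_closedBall_pos volume c hs).ne' measure_closedBall_lt_top.ne hx hx'
  rw [Module.finrank_fin_fun, hvol] at hmorrey
  refine hmorrey.trans ?_
  rw [← hconst]
  gcongr

section Mollification

variable {n : ℕ} {F : (Fin n → ℝ) → ℝ} {K : Set (Fin n → ℝ)} {z : Fin n → ℝ}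

theorem lintegral_ofReal_normed {E : Type*} [NormedAddCommGroup E] [NormedSpace ℝ E]
    [HasContDiffBump E] [MeasurableSpace E] [BorelSpace E] [FiniteDimensional ℝ E] {c : E}
    (φ : ContDiffBump c) (μ : Measure E) [IsLocallyFiniteMeasure μ] [μ.IsOpenPosMeasure] :
    ∫⁻ t, ENNReal.ofReal (φ.normed μ t) ∂μ = 1 := by
  rw [← ofReal_integral_eq_lintegral_ofReal φ.integrable_normed
    (Eventually.of_forall φ.nonneg_normed), φ.integral_normed, ENNReal.ofReal_one]

theorem tsupport_normed_const_sub_subset (φ : ContDiffBump (0 : Fin n → ℝ)) (z : Fin n → ℝ) :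
    tsupport (fun t => φ.normed volume (z - t)) ⊆ Metric.closedBall z φ.rOut := by
  refine closure_minimal (fun t ht => ?_) Metric.isClosed_closedBall
  have hmem : z - t ∈ Metric.ball 0 φ.rOut := φ.support_normed_eq (μ := volume) ▸ ht
  rw [mem_ball_zero_iff, ← dist_eq_norm, dist_comm] at hmem
  exact Metric.mem_closedBall.2 hmem.le

theorem enorm_clm_le_of_forall_single (l : (Fin n → ℝ) →L[ℝ] ℝ) {b : ℝ≥0∞}
    (h : ∀ i, ‖l (Pi.single i 1)‖ₑ ≤ b) : ‖l‖ₑ ≤ n * b := by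
  refine ContinuousLinearMap.opENorm_le_bound l fun v => ?_
  calc ‖l v‖ₑ = ‖∑ i, v i * l (Pi.single i 1)‖ₑ := by
        conv_lhs => rw [pi_eq_sum_univ' v]
        simp only [map_sum, map_smul, smul_eq_mul]
    _ ≤ ∑ i, ‖v i * l (Pi.single i 1)‖ₑ := enorm_sum_le _ _
    _ ≤ ∑ _i : Fin n, ‖v‖ₑ * b := Finset.sum_le_sum fun i _ => by
        rw [enorm_mul]
        exact mul_le_mul' (enorm_le_iff_norm_le.2 (norm_le_pi_norm v i)) (h i)
    _ = n * b * ‖v‖ₑ := by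
        rw [Finset.sum_const, Finset.card_fin, nsmul_eq_mul]
        ring

/-- The mollification `F 1_K ⋆ φ` of the restriction of `F` to the set `K`. -/
def mollify (F : (Fin n → ℝ) → ℝ) (K : Set (Fin n → ℝ)) (φ : ContDiffBump (0 : Fin n → ℝ)) :
    (Fin n → ℝ) → ℝ :=
  convolution (K.indicator F) (φ.normed volume) (ContinuousLinearMap.mul ℝ ℝ) volume

theorem locallyIntegrable_indicator_of_isCompact (hF : ContinuousOn F K) (hK : IsCompact K) :
    LocallyIntegrable (K.indicator F) volume :=
  ((integrable_indicator_iff hK.measurableSet).2 (hF.integrableOn_compact hK)).locallyIntegrable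

theorem contDiff_mollify (hF : ContinuousOn F K) (hK : IsCompact K)
    (φ : ContDiffBump (0 : Fin n → ℝ)) {m : ℕ∞} : ContDiff ℝ m (mollify F K φ) :=
  φ.hasCompactSupport_normed.contDiff_convolution_right _
    (locallyIntegrable_indicator_of_isCompact hF hK) φ.contDiff_normed

theorem fderiv_mollify_apply (hF : ContinuousOn F K) (hK : IsCompact K)
    (φ : ContDiffBump (0 : Fin n → ℝ)) (z v : Fin n → ℝ) :
    fderiv ℝ (mollify F K φ) z v = ∫ t in K, F t * fderiv ℝ (φ.normed volume) (z - t) v := by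
  have hloc := locallyIntegrable_indicator_of_isCompact hF hK
  have hφ : ContDiff ℝ 1 (φ.normed volume) := φ.contDiff_normed (n := 1)
  rw [mollify, (φ.hasCompactSupport_normed.hasFDerivAt_convolution_right
      (ContinuousLinearMap.mul ℝ ℝ) hloc hφ z).fderiv,
    convolution_precompR_apply _ hloc (φ.hasCompactSupport_normed.fderiv ℝ)
      (hφ.continuous_fderiv one_ne_zero), ← integral_indicator hK.measurableSet]
  simp only [indicator_mul_left]
  rfl

theorem tendsto_mollify {ι : Type*} {l : Filter ι} (hF : ContinuousOn F K) (hK : IsCompact K)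
    (hz : K ∈ 𝓝 z) {φ : ι → ContDiffBump (0 : Fin n → ℝ)}
    (hφ : Tendsto (fun k => (φ k).rOut) l (𝓝 0)) :
    Tendsto (fun k => mollify F K (φ k) z) l (𝓝 (F z)) := by
  have hlim := ContDiffBump.convolution_tendsto_right (μ := volume) (g := fun _ => K.indicator F)
    (k := fun _ => z) hφ
    (Eventually.of_forall fun _ =>
      (locallyIntegrable_indicator_of_isCompact hF hK).aestronglyMeasurable)
    (((hF.continuousAt hz).congr
      (mem_of_superset hz fun y hy => (indicator_of_mem hy F).symm)).tendsto.comp tendsto_snd)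
    tendsto_const_nhds
  rw [indicator_of_mem (mem_of_mem_nhds hz)] at hlim
  simpa only [mollify, convolution_mul_swap, convolution_lsmul, smul_eq_mul, mul_comm] using hlim

end Mollification

namespace SpaceDomain

variable {n : ℕ} {Ω : SpaceDomain n} {F : (Fin n → ℝ) → ℝ} {g : (Fin n → ℝ) → Fin n → ℝ}
  {K : Set (Fin n → ℝ)} {z : Fin n → ℝ}

theorem IsWeakGradient.setIntegral_mul_fderiv (hg : Ω.IsWeakGradient F g) (hK : IsCompact K)
    (hKΩ : K ⊆ Ω.carrier) {ψ : (Fin n → ℝ) → ℝ} (hψ : ContDiff ℝ (⊤ : ℕ∞) ψ)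
    (hψK : tsupport ψ ⊆ K) (i : Fin n) :
    ∫ t in K, F t * fderiv ℝ ψ t (Pi.single i 1) = -∫ t in K, g t i * ψ t := by
  have hweak := hg ψ hψ (hK.of_isClosed_subset (isClosed_tsupport ψ) hψK) (hψK.trans hKΩ) i
  rw [setIntegral_eq_of_subset_of_forall_sdiff_eq_zero Ω.isOpen.measurableSet hKΩ fun t ht => ?_,
    setIntegral_eq_of_subset_of_forall_sdiff_eq_zero Ω.isOpen.measurableSet hKΩ
      fun t ht => ?_] at hweak
  · exact hweak
  · rw [image_eq_zero_of_notMem_tsupport fun h => ht.2 (hψK h), mul_zero]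
  · rw [image_eq_zero_of_notMem_tsupport fun h => ht.2 (hψK (tsupport_fderiv_subset ℝ h)),
      zero_apply, mul_zero]

theorem IsWeakGradient.fderiv_mollify_single (hg : Ω.IsWeakGradient F g) (hF : ContinuousOn F K)
    (hK : IsCompact K) (hKΩ : K ⊆ Ω.carrier) (φ : ContDiffBump (0 : Fin n → ℝ))
    (hz : Metric.closedBall z φ.rOut ⊆ K) (i : Fin n) :
    fderiv ℝ (mollify F K φ) z (Pi.single i 1) = ∫ t in K, g t i * φ.normed volume (z - t) := by
  have hφ : ContDiff ℝ 1 (φ.normed volume) := φ.contDiff_normed (n := 1)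
  have hreflect : ∀ t, fderiv ℝ (fun t => φ.normed volume (z - t)) t (Pi.single i 1) =
      -fderiv ℝ (φ.normed volume) (z - t) (Pi.single i 1) := fun t => by
    have hchain : HasFDerivAt (fun t => φ.normed volume (z - t)) _ t :=
      (hφ.differentiable one_ne_zero (z - t)).hasFDerivAt.comp t ((hasFDerivAt_id t).const_sub z)
    rw [hchain.fderiv, ContinuousLinearMap.comp_apply, neg_apply,
      ContinuousLinearMap.id_apply, map_neg]
  have hparts := hg.setIntegral_mul_fderiv (ψ := fun t => φ.normed volume (z - t)) hK hKΩ
    (φ.contDiff_normed.comp (contDiff_const.sub contDiff_id))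
    ((tsupport_normed_const_sub_subset φ z).trans hz) i
  simp only [hreflect, mul_neg, integral_neg, neg_inj] at hparts
  rw [fderiv_mollify_apply hF hK, hparts]

theorem IsSobolevWith.enorm_fderiv_mollify_le {p : ℝ} (h : Ω.IsSobolevWith p F g)
    (hK : IsCompact K) (hKΩ : K ⊆ Ω.carrier) (φ : ContDiffBump (0 : Fin n → ℝ))
    (hz : Metric.closedBall z φ.rOut ⊆ K) :
    ‖fderiv ℝ (mollify F K φ) z‖ₑ ≤
      n * ∫⁻ t in K, ‖g t‖ₑ * ENNReal.ofReal (φ.normed volume (z - t)) := by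
  refine enorm_clm_le_of_forall_single _ fun i => ?_
  rw [h.isWeakGradient.fderiv_mollify_single (h.continuousOn.mono hKΩ) hK hKΩ φ hz i]
  refine (enorm_integral_le_lintegral_enorm _).trans (lintegral_mono fun t => ?_)
  rw [enorm_mul, Real.enorm_eq_ofReal (φ.nonneg_normed _)]
  exact mul_le_mul' (enorm_le_iff_norm_le.2 (norm_le_pi_norm (g t) i)) le_rfl

theorem IsSobolevWith.aemeasurable_enorm {p : ℝ} (h : Ω.IsSobolevWith p F g)
    (hKΩ : K ⊆ Ω.carrier) : AEMeasurable (fun t => ‖g t‖ₑ) (volume.restrict K) :=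
  (h.memLp.aestronglyMeasurable.mono_measure (Measure.restrict_mono hKΩ le_rfl)).enorm

theorem IsSobolevWith.enorm_fderiv_mollify_rpow_le {p : ℝ} (h : Ω.IsSobolevWith p F g)
    (hp : 1 ≤ p) (hK : IsCompact K) (hKΩ : K ⊆ Ω.carrier) (φ : ContDiffBump (0 : Fin n → ℝ))
    (hz : Metric.closedBall z φ.rOut ⊆ K) :
    ‖fderiv ℝ (mollify F K φ) z‖ₑ ^ p ≤
      (n : ℝ≥0∞) ^ p * ∫⁻ t in K, ‖g t‖ₑ ^ p * ENNReal.ofReal (φ.normed volume (z - t)) := by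
  have hp0 : 0 < p := by linarith
  have hkernel : Measurable fun t => ENNReal.ofReal (φ.normed volume (z - t)) :=
    (φ.continuous_normed.comp (continuous_const.sub continuous_id)).measurable.ennreal_ofReal
  have hmass : (∫⁻ t in K, ENNReal.ofReal (φ.normed volume (z - t))) ^ (1 - 1 / p) ≤ 1 := by
    refine ENNReal.rpow_le_one ((setLIntegral_le_lintegral _ _).trans ?_)
      (sub_nonneg.2 ((div_le_one hp0).2 hp))
    rw [lintegral_sub_left_eq_self (fun t => ENNReal.ofReal (φ.normed volume t)) z,
      lintegral_ofReal_normed]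
  calc ‖fderiv ℝ (mollify F K φ) z‖ₑ ^ p
      ≤ (n * ∫⁻ t in K, ‖g t‖ₑ * ENNReal.ofReal (φ.normed volume (z - t))) ^ p :=
        ENNReal.rpow_le_rpow (h.enorm_fderiv_mollify_le hK hKΩ φ hz) hp0.le
    _ ≤ (n * ((∫⁻ t in K, ‖g t‖ₑ ^ p * ENNReal.ofReal (φ.normed volume (z - t))) ^ (1 / p) *
          1)) ^ p := by
        gcongr
        exact (lintegral_mul_le_lintegral_rpow_mul _ hp (h.aemeasurable_enorm hKΩ)
          hkernel.aemeasurable).trans (mul_le_mul_right hmass _)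
    _ = _ := by
        rw [mul_one, ENNReal.mul_rpow_of_nonneg _ _ hp0.le, ← ENNReal.rpow_mul,
          one_div_mul_cancel hp0.ne', ENNReal.rpow_one]

theorem IsSobolevWith.setLIntegral_fderiv_mollify_le {p : ℝ} (h : Ω.IsSobolevWith p F g)
    (hp : 1 ≤ p) (hK : IsCompact K) (hKΩ : K ⊆ Ω.carrier) {B : Set (Fin n → ℝ)}
    (hB : MeasurableSet B) (φ : ContDiffBump (0 : Fin n → ℝ))
    (hBK : ∀ z ∈ B, Metric.closedBall z φ.rOut ⊆ K) :
    ∫⁻ z in B, ‖fderiv ℝ (mollify F K φ) z‖ₑ ^ p ≤ (n : ℝ≥0∞) ^ p * ∫⁻ t in K, ‖g t‖ₑ ^ p := by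
  have hkernel : Measurable fun q : (Fin n → ℝ) × (Fin n → ℝ) =>
      ENNReal.ofReal (φ.normed volume (q.1 - q.2)) :=
    (φ.continuous_normed.comp (continuous_fst.sub continuous_snd)).measurable.ennreal_ofReal
  have hmass : ∀ t, ∫⁻ z in B, ENNReal.ofReal (φ.normed volume (z - t)) ≤ 1 := fun t => by
    refine (setLIntegral_le_lintegral _ _).trans ?_
    rw [lintegral_sub_right_eq_self (fun t => ENNReal.ofReal (φ.normed volume t)) t,
      lintegral_ofReal_normed]
  calc ∫⁻ z in B, ‖fderiv ℝ (mollify F K φ) z‖ₑ ^ p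
      ≤ ∫⁻ z in B, (n : ℝ≥0∞) ^ p *
          ∫⁻ t in K, ‖g t‖ₑ ^ p * ENNReal.ofReal (φ.normed volume (z - t)) :=
        setLIntegral_mono' hB fun z hz =>
          h.enorm_fderiv_mollify_rpow_le hp hK hKΩ φ (hBK z hz)
    _ = (n : ℝ≥0∞) ^ p * ∫⁻ t in K, ∫⁻ z in B,
          ‖g t‖ₑ ^ p * ENNReal.ofReal (φ.normed volume (z - t)) := by
        rw [lintegral_const_mul' _ _ (by finiteness), lintegral_lintegral_swap
          ((((h.aemeasurable_enorm hKΩ).pow_const p).comp_snd (μ := volume.restrict B)).mul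
            hkernel.aemeasurable)]
    _ ≤ (n : ℝ≥0∞) ^ p * ∫⁻ t in K, ‖g t‖ₑ ^ p := by
        refine mul_le_mul_right (lintegral_mono fun t => ?_) _
        rw [lintegral_const_mul' _ _ (ENNReal.rpow_ne_top_of_nonneg (by linarith) enorm_ne_top)]
        exact mul_le_of_le_one_right' (hmass t)

theorem IsSobolevWith.enorm_sub_rpow_le {p : ℝ} (h : Ω.IsSobolevWith p F g) (hp1 : 1 ≤ p)
    (hp : (n : ℝ) < p) {c x x' : Fin n → ℝ} {r : ℝ} (hr : 0 < r)
    (hc : Metric.closedBall c r ⊆ Ω.carrier) (hx : x ∈ Metric.closedBall c (r / 2))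
    (hx' : x' ∈ Metric.closedBall c (r / 2)) :
    ‖F x - F x'‖ₑ ^ p ≤ ENNReal.ofReal (morreyConst n p * (r / 2) ^ (p - n)) *
      ((n : ℝ≥0∞) ^ p * ∫⁻ t in Metric.closedBall c r, ‖g t‖ₑ ^ p) := by
  have hK : IsCompact (Metric.closedBall c r) := isCompact_closedBall c r
  have hF := h.continuousOn.mono hc
  have hsub : ∀ z ∈ Metric.closedBall c (r / 2),
      Metric.closedBall z (r / 2) ⊆ Metric.closedBall c r := fun z hz =>
    Metric.closedBall_subset_closedBall' (by linarith [Metric.mem_closedBall.1 hz])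
  have hnhds : ∀ z ∈ Metric.closedBall c (r / 2), Metric.closedBall c r ∈ 𝓝 z := fun z hz =>
    mem_of_superset (Metric.closedBall_mem_nhds z (by positivity)) (hsub z hz)
  let φ : ℕ → ContDiffBump (0 : Fin n → ℝ) := fun k =>
    ⟨r / 2 * (1 / (k + 1)) / 2, r / 2 * (1 / (k + 1)), by positivity, half_lt_self (by positivity)⟩
  have hφ : Tendsto (fun k => (φ k).rOut) atTop (𝓝 0) := by
    simpa only [mul_zero] using tendsto_one_div_add_atTop_nhds_zero_nat.const_mul (r / 2)
  have hφle : ∀ k, (φ k).rOut ≤ r / 2 := fun k =>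
    mul_le_of_le_one_right (by positivity) (one_div_natCast_add_one_mem_Ioc k).2
  have hlim := ((tendsto_mollify hF hK (hnhds x hx) hφ).sub
    (tendsto_mollify hF hK (hnhds x' hx') hφ)).enorm.ennrpow_const p
  refine le_of_tendsto hlim (Eventually.of_forall fun k => ?_)
  refine (enorm_sub_rpow_le_of_mem_closedBall hp1 hp (contDiff_mollify hF hK (φ k))
    (by positivity) hx hx').trans (mul_le_mul_right ?_ _)
  exact h.setLIntegral_fderiv_mollify_le hp1 hK hc measurableSet_closedBall (φ k)
    fun z hz => (Metric.closedBall_subset_closedBall (hφle k)).trans (hsub z hz)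

end SpaceDomain

/-! ### The metric of the completion and cones with apex on the boundary -/

namespace SpaceDomain

variable {n : ℕ} {Ω : SpaceDomain n} {α : Ioc (0 : ℝ) 1}

theorem ofReal_le_infEDist_frontier {x : Fin n → ℝ} {ρ : ℝ}
    (h : Metric.ball x ρ ⊆ Ω.carrier) :
    ENNReal.ofReal ρ ≤ Metric.infEDist x (frontier Ω.carrier) := by
  refine Metric.le_infEDist.2 fun w hw => ?_
  rw [edist_dist]
  refine ENNReal.ofReal_le_ofReal (le_of_not_gt fun hlt => ?_)
  rw [Ω.isOpen.frontier_eq] at hw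
  exact hw.2 (h (Metric.mem_ball'.2 hlt))

theorem infEDist_rpow_le_of_ball_subset {x : Fin n → ℝ} {ρ q : ℝ} (hρ : 0 < ρ) (hq : q ≤ 0)
    (h : Metric.ball x ρ ⊆ Ω.carrier) :
    Metric.infEDist x (frontier Ω.carrier) ^ q ≤ ENNReal.ofReal (ρ ^ q) := by
  rw [← ENNReal.ofReal_rpow_of_pos hρ]
  exact ennreal_rpow_le_rpow_of_nonpos (ofReal_le_infEDist_frontier h) hq

theorem isArcLengthCurve_lineMap {a b : Fin n → ℝ} (hab : a ≠ b) {s u : ℝ} (hsu : s ≤ u)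
    (h : ∀ v ∈ Icc s u, AffineMap.lineMap a b v ∈ Ω.carrier) :
    Ω.IsArcLengthCurve (AffineMap.lineMap a b s) (AffineMap.lineMap a b u) (dist a b * (u - s))
      (fun t => AffineMap.lineMap a b (s + t / dist a b)) := by
  have hd : 0 < dist a b := dist_pos.2 hab
  have hiso : Isometry fun t : ℝ => (AffineMap.lineMap a b (s + t / dist a b) : Fin n → ℝ) :=
    Isometry.of_dist_eq fun t t' => by
      rw [dist_lineMap_lineMap, Real.dist_eq, Real.dist_eq, add_sub_add_left_eq_sub, ← sub_div,
        abs_div, abs_of_pos hd, div_mul_cancel₀ _ hd.ne']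
  refine ⟨mul_nonneg hd.le (sub_nonneg.2 hsu), hasUnitSpeedOn_of_isometry hiso _ _, by simp,
    by simp [hd.ne'], fun t ht => h _ ⟨?_, ?_⟩⟩
  · exact le_add_of_nonneg_right (div_nonneg ht.1 hd.le)
  · linarith [(div_le_iff₀' hd).2 ht.2]

theorem subhypEDist_lineMap_le (α : ℝ) {a b : Fin n → ℝ} {s u : ℝ} (hsu : s ≤ u)
    (h : ∀ v ∈ Icc s u, AffineMap.lineMap a b v ∈ Ω.carrier) :
    Ω.subhypEDist α (AffineMap.lineMap a b s) (AffineMap.lineMap a b u) ≤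
      ENNReal.ofReal (dist a b) * ∫⁻ v in Icc s u,
        Metric.infEDist (AffineMap.lineMap a b v) (frontier Ω.carrier) ^ (α - 1) := by
  rcases eq_or_ne a b with rfl | hab
  · have ha : a ∈ Ω.carrier := by simpa using h s (left_mem_Icc.2 hsu)
    simp [Ω.subhypEDist_self α ha]
  have hd : 0 < dist a b := dist_pos.2 hab
  have himage : (fun v => dist a b * (v - s)) '' Icc s u = Icc 0 (dist a b * (u - s)) := by
    rw [← image_image (dist a b * ·) (· - s), image_sub_const_Icc, image_mul_left_Icc' hd,
      sub_self, mul_zero]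
  refine iInf₂_le_of_le _ _ (iInf_le_of_le (isArcLengthCurve_lineMap hab hsu h) (le_of_eq ?_))
  rw [subhypLength, ← himage, lintegral_image_eq_lintegral_abs_deriv_mul measurableSet_Icc
      (fun v _ => (((hasDerivAt_id' v).sub_const s).const_mul (dist a b)).hasDerivWithinAt)
      (fun v _ w _ hvw => sub_left_injective (mul_left_cancel₀ hd.ne' hvw)),
    ← lintegral_const_mul' _ _ ENNReal.ofReal_ne_top]
  simp [abs_of_pos hd, mul_div_cancel_left₀ _ hd.ne']

theorem subhypDist_le_of_ball_subset {α : ℝ} (hα : α ≤ 1) {x c : Fin n → ℝ} {R : ℝ}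
    (h : Metric.ball c R ⊆ Ω.carrier) (hx : dist x c < R) :
    Ω.subhypDist α x c ≤ dist x c * (R - dist x c) ^ (α - 1) := by
  have hρ : 0 < R - dist x c := sub_pos.2 hx
  have hball : ∀ v ∈ Icc (0 : ℝ) 1,
      Metric.ball (AffineMap.lineMap x c v) (R - dist x c) ⊆ Ω.carrier := fun v hv => by
    refine (Metric.ball_subset_ball' ?_).trans h
    rw [dist_lineMap_right, Real.norm_of_nonneg (sub_nonneg.2 hv.2)]
    nlinarith [hv.1, dist_nonneg (x := x) (y := c)]
  have hsegment := subhypEDist_lineMap_le α zero_le_one fun v hv =>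
    hball v hv (Metric.mem_ball_self hρ)
  rw [AffineMap.lineMap_apply_zero, AffineMap.lineMap_apply_one] at hsegment
  refine ENNReal.toReal_le_of_le_ofReal (by positivity) (hsegment.trans ?_)
  rw [ENNReal.ofReal_mul dist_nonneg]
  gcongr
  refine (setLIntegral_mono' measurableSet_Icc fun v hv =>
    infEDist_rpow_le_of_ball_subset hρ (sub_nonpos.2 hα) (hball v hv)).trans_eq ?_
  simp

/-- The points of `Ω` as points of the metric space `Ω.Subhyp α`. -/
def toSubhyp (α : Ioc (0 : ℝ) 1) {x : Fin n → ℝ} (hx : x ∈ Ω.carrier) : Ω.Subhyp α :=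
  (⟨x, hx⟩ : ↥Ω.carrier)

@[simp]
theorem pt_toSubhyp {x : Fin n → ℝ} (hx : x ∈ Ω.carrier) : (toSubhyp α hx).pt = x :=
  rfl

theorem Subhyp.isInducing_pt : IsInducing (Subhyp.pt : Ω.Subhyp α → Fin n → ℝ) := by
  refine isInducing_iff_nhds.2 fun x => le_antisymm
    (map_le_iff_le_comap.1 (Subhyp.uniformContinuous_pt Ω α).continuous.continuousAt) ?_
  obtain ⟨ε, hε, hball⟩ := Metric.isOpen_iff.1 Ω.isOpen x.pt x.pt_mem
  have hpt : Tendsto (fun y : Ω.Subhyp α => dist y.pt x.pt) (comap Subhyp.pt (𝓝 x.pt)) (𝓝 0) :=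
    tendsto_iff_dist_tendsto_zero.1 tendsto_comap
  have hbound : Tendsto (fun y : Ω.Subhyp α => dist y.pt x.pt * (ε - dist y.pt x.pt) ^ ((α : ℝ) - 1)
      + dist y.pt x.pt ^ (α : ℝ)) (comap Subhyp.pt (𝓝 x.pt)) (𝓝 0) := by
    have hpos : ε - 0 ≠ 0 := by simpa using hε.ne'
    have h := (hpt.mul ((hpt.const_sub ε).rpow_const (p := (α : ℝ) - 1) (Or.inl hpos))).add
      (hpt.rpow_const (p := (α : ℝ)) (Or.inr α.2.1.le))
    simpa [Real.zero_rpow α.2.1.ne'] using h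
  refine tendsto_iff_dist_tendsto_zero.2 (squeeze_zero' (Eventually.of_forall fun _ => dist_nonneg)
    ?_ hbound)
  filter_upwards [hpt.eventually (gt_mem_nhds hε)] with y hy
  rw [Subhyp.dist_def, ← dist_eq_norm]
  gcongr
  exact subhypDist_le_of_ball_subset α.2.2 hball hy

namespace IsArcLengthCurve

variable {x y : Fin n → ℝ} {L : ℝ} {γ : ℝ → Fin n → ℝ}

theorem edist_source_le (h : Ω.IsArcLengthCurve x y L γ) {s : ℝ} (hs : s ∈ Icc 0 L) :
    edist x (γ s) ≤ ENNReal.ofReal s := by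
  simpa [h.source] using
    edist_le_of_hasUnitSpeedOn h.unitSpeed (left_mem_Icc.2 h.nonneg) hs hs.1

theorem dist_le (h : Ω.IsArcLengthCurve x y L γ) : dist x y ≤ L := by
  have hend := h.edist_source_le (right_mem_Icc.2 h.nonneg)
  rw [h.target, edist_dist] at hend
  exact (ENNReal.ofReal_le_ofReal_iff h.nonneg).1 hend

theorem ofReal_dist_mul_le_subhypLength (h : Ω.IsArcLengthCurve x y L γ) {α : ℝ} (hα : α ≤ 1) :
    ENNReal.ofReal (dist x y) *
        (Metric.infEDist x (frontier Ω.carrier) + ENNReal.ofReal (dist x y)) ^ (α - 1) ≤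
      Ω.subhypLength α L γ := by
  have hpoint : ∀ s ∈ Icc 0 (dist x y),
      (Metric.infEDist x (frontier Ω.carrier) + ENNReal.ofReal (dist x y)) ^ (α - 1) ≤
        Metric.infEDist (γ s) (frontier Ω.carrier) ^ (α - 1) := fun s hs => by
    refine ennreal_rpow_le_rpow_of_nonpos ?_ (sub_nonpos.2 hα)
    refine Metric.infEDist_le_infEDist_add_edist.trans (add_le_add_right ?_ _)
    rw [edist_comm]
    exact (h.edist_source_le ⟨hs.1, hs.2.trans h.dist_le⟩).trans (ENNReal.ofReal_le_ofReal hs.2)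
  calc _ = ∫⁻ _ in Icc 0 (dist x y),
          (Metric.infEDist x (frontier Ω.carrier) + ENNReal.ofReal (dist x y)) ^ (α - 1) := by
        rw [setLIntegral_const, Real.volume_Icc, sub_zero, mul_comm]
    _ ≤ ∫⁻ s in Icc 0 (dist x y), Metric.infEDist (γ s) (frontier Ω.carrier) ^ (α - 1) :=
        setLIntegral_mono' measurableSet_Icc hpoint
    _ ≤ Ω.subhypLength α L γ := lintegral_mono_set (Icc_subset_Icc_right h.dist_le)

end IsArcLengthCurve

theorem dist_le_subhypDist_mul (hne : (frontier Ω.carrier).Nonempty) (x y : Ω.Subhyp α) :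
    dist x.pt y.pt ≤ Ω.subhypDist α x.pt y.pt *
      (Metric.infDist x.pt (frontier Ω.carrier) + dist x.pt y.pt) ^ (1 - (α : ℝ)) := by
  rcases eq_or_ne x.pt y.pt with hxy | hxy
  · rw [hxy, dist_self]
    exact mul_nonneg (Ω.subhypDist_nonneg _ _ _)
      (Real.rpow_nonneg (add_nonneg Metric.infDist_nonneg le_rfl) _)
  set w := Metric.infDist x.pt (frontier Ω.carrier) + dist x.pt y.pt with hw
  have hwpos : 0 < w := add_pos_of_nonneg_of_pos Metric.infDist_nonneg (dist_pos.2 hxy)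
  have hedist : ENNReal.ofReal (dist x.pt y.pt * w ^ ((α : ℝ) - 1)) ≤
      Ω.subhypEDist α x.pt y.pt := by
    refine le_iInf₂ fun L γ => le_iInf fun h => ?_
    rw [ENNReal.ofReal_mul dist_nonneg, ← ENNReal.ofReal_rpow_of_pos hwpos, hw,
      ENNReal.ofReal_add Metric.infDist_nonneg dist_nonneg, Metric.infDist,
      ENNReal.ofReal_toReal (Metric.infEDist_ne_top hne)]
    exact h.ofReal_dist_mul_le_subhypLength α.2.2
  have hreal : dist x.pt y.pt * w ^ ((α : ℝ) - 1) ≤ Ω.subhypDist α x.pt y.pt :=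
    (ENNReal.ofReal_le_iff_le_toReal (Ω.subhypEDist_ne_top α.2.2 x.pt_mem y.pt_mem)).1 hedist
  calc dist x.pt y.pt = dist x.pt y.pt * w ^ ((α : ℝ) - 1) * w ^ (1 - (α : ℝ)) := by
        rw [mul_assoc, ← Real.rpow_add hwpos]
        simp
    _ ≤ _ := by gcongr

end SpaceDomain

namespace SpaceDomain

variable {n : ℕ} {Ω : SpaceDomain n} {α : Ioc (0 : ℝ) 1}

theorem limitPoint_coe (x : Ω.Subhyp α) : Ω.limitPoint α x = x.pt :=
  Completion.extension_coe (Subhyp.uniformContinuous_pt Ω α) x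

theorem continuous_limitPoint : Continuous (Ω.limitPoint α) :=
  Completion.continuous_extension

theorem closureDist_coe (x y : Ω.Subhyp α) : Ω.closureDist α x y = Ω.subhypDist α x.pt y.pt :=
  Completion.extension₂_coe_coe (Subhyp.uniformContinuous₂_subhypDist Ω α) x y

theorem continuous_closureDist :
    Continuous fun q : Ω.SubhypCompletion α × Ω.SubhypCompletion α =>
      Ω.closureDist α q.1 q.2 :=
  (Completion.uniformContinuous_extension₂ _).continuous

theorem closureDist_nonneg (ω₁ ω₂ : Ω.SubhypCompletion α) : 0 ≤ Ω.closureDist α ω₁ ω₂ := by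
  induction ω₁, ω₂ using Completion.induction_on₂ with
  | hp => exact isClosed_le continuous_const continuous_closureDist
  | ih x y => exact closureDist_coe x y ▸ Ω.subhypDist_nonneg _ _ _

theorem dist_eq_closureDist_add (ω₁ ω₂ : Ω.SubhypCompletion α) :
    dist ω₁ ω₂ =
      Ω.closureDist α ω₁ ω₂ + dist (Ω.limitPoint α ω₁) (Ω.limitPoint α ω₂) ^ (α : ℝ) := by
  have hlimit := continuous_limitPoint (Ω := Ω) (α := α)
  induction ω₁, ω₂ using Completion.induction_on₂ with
  | hp =>
    refine isClosed_eq continuous_dist (continuous_closureDist.add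
      (Continuous.rpow_const ?_ fun _ => Or.inr α.2.1.le))
    fun_prop
  | ih x y =>
    rw [Completion.dist_eq, closureDist_coe, limitPoint_coe, limitPoint_coe, Subhyp.dist_def,
      dist_eq_norm x.pt]

theorem closureDist_le_dist (ω₁ ω₂ : Ω.SubhypCompletion α) :
    Ω.closureDist α ω₁ ω₂ ≤ dist ω₁ ω₂ := by
  rw [dist_eq_closureDist_add]
  exact le_add_of_nonneg_right (Real.rpow_nonneg dist_nonneg _)

theorem limitPoint_mem_closure (ω : Ω.SubhypCompletion α) :
    Ω.limitPoint α ω ∈ closure Ω.carrier := by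
  induction ω using Completion.induction_on with
  | hp => exact isClosed_closure.preimage continuous_limitPoint
  | ih x => exact limitPoint_coe x ▸ subset_closure x.pt_mem

theorem mem_range_of_limitPoint_mem {ω : Ω.SubhypCompletion α}
    (h : Ω.limitPoint α ω ∈ Ω.carrier) :
    ω ∈ range ((↑) : Ω.Subhyp α → Ω.SubhypCompletion α) := by
  have hneBot : (comap ((↑) : Ω.Subhyp α → Ω.SubhypCompletion α) (𝓝 ω)).NeBot :=
    Completion.isDenseInducing_coe.comap_nhds_neBot ω
  have hpt : Tendsto (Subhyp.pt : Ω.Subhyp α → Fin n → ℝ)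
      (comap ((↑) : Ω.Subhyp α → Ω.SubhypCompletion α) (𝓝 ω)) (𝓝 (Ω.limitPoint α ω)) := by
    simpa [Function.comp_def, limitPoint_coe] using
      (continuous_limitPoint.tendsto ω).comp
        (tendsto_comap (f := ((↑) : Ω.Subhyp α → Ω.SubhypCompletion α)))
  have hcoe : Tendsto ((↑) : Ω.Subhyp α → Ω.SubhypCompletion α) (comap (↑) (𝓝 ω))
      (𝓝 (toSubhyp α h)) :=
    (Completion.continuous_coe _).continuousAt.tendsto.comp
      (Subhyp.isInducing_pt.tendsto_nhds_iff.2 hpt)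
  exact ⟨toSubhyp α h, tendsto_nhds_unique hcoe tendsto_comap⟩

theorem mem_alphaBoundary_iff {ω : Ω.SubhypCompletion α} :
    ω ∈ Ω.alphaBoundary α ↔ Ω.limitPoint α ω ∈ frontier Ω.carrier := by
  rw [Ω.isOpen.frontier_eq, alphaBoundary, frontier, Completion.denseRange_coe.closure_eq]
  refine ⟨fun h => ⟨limitPoint_mem_closure ω, fun hmem => h.2 ?_⟩,
    fun h => ⟨mem_univ _, fun hmem => h.2 ?_⟩⟩
  · exact mem_interior.2 ⟨Ω.limitPoint α ⁻¹' Ω.carrier, fun _ => mem_range_of_limitPoint_mem,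
      Ω.isOpen.preimage continuous_limitPoint, hmem⟩
  · obtain ⟨x, rfl⟩ := interior_subset hmem
    exact limitPoint_coe x ▸ x.pt_mem

theorem dist_limitPoint_le_closureDist_mul (hne : (frontier Ω.carrier).Nonempty)
    (ω₁ ω₂ : Ω.SubhypCompletion α) :
    dist (Ω.limitPoint α ω₁) (Ω.limitPoint α ω₂) ≤ Ω.closureDist α ω₁ ω₂ *
      (Metric.infDist (Ω.limitPoint α ω₁) (frontier Ω.carrier) +
        dist (Ω.limitPoint α ω₁) (Ω.limitPoint α ω₂)) ^ (1 - (α : ℝ)) := by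
  have hlimit := continuous_limitPoint (Ω := Ω) (α := α)
  have hinfDist := Metric.continuous_infDist_pt (frontier Ω.carrier)
  induction ω₁, ω₂ using Completion.induction_on₂ with
  | hp =>
    refine isClosed_le (by fun_prop) (continuous_closureDist.mul (Continuous.rpow_const ?_
      fun _ => Or.inr (sub_nonneg.2 α.2.2)))
    exact (hinfDist.comp (hlimit.comp continuous_fst)).add (by fun_prop)
  | ih x y => simpa only [closureDist_coe, limitPoint_coe] using dist_le_subhypDist_mul hne x y

theorem dist_limitPoint_rpow_le {ω₁ : Ω.SubhypCompletion α} (h₁ : ω₁ ∈ Ω.alphaBoundary α)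
    (ω₂ : Ω.SubhypCompletion α) :
    dist (Ω.limitPoint α ω₁) (Ω.limitPoint α ω₂) ^ (α : ℝ) ≤ Ω.closureDist α ω₁ ω₂ := by
  rw [mem_alphaBoundary_iff] at h₁
  have h := dist_limitPoint_le_closureDist_mul ⟨_, h₁⟩ ω₁ ω₂
  rw [Metric.infDist_zero_of_mem h₁, zero_add] at h
  rcases (dist_nonneg (x := Ω.limitPoint α ω₁) (y := Ω.limitPoint α ω₂)).eq_or_lt with h0 | h0
  · rw [← h0, Real.zero_rpow α.2.1.ne']
    exact closureDist_nonneg ω₁ ω₂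
  · rw [Real.rpow_sub h0, Real.rpow_one, mul_div_assoc', le_div_iff₀' (by positivity)] at h
    exact le_of_mul_le_mul_right (by linarith) h0

/-- `Ω` contains the open cone with apex `a` and axis from `a` to `b`, whose section at the point
of parameter `u` of the axis is a ball of radius `u * r`. The curves that approach a visible
boundary element run inside such cones. -/
structure ContainsCone (Ω : SpaceDomain n) (a b : Fin n → ℝ) (r : ℝ) : Prop where
  radius_pos : 0 < r
  ball_subset : ∀ u ∈ Ioc (0 : ℝ) 1, Metric.ball (AffineMap.lineMap a b u) (u * r) ⊆ Ω.carrier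

namespace ContainsCone

variable {a b : Fin n → ℝ} {r : ℝ}

theorem mem (h : Ω.ContainsCone a b r) {u : ℝ} (hu : u ∈ Ioc (0 : ℝ) 1) :
    AffineMap.lineMap a b u ∈ Ω.carrier :=
  h.ball_subset u hu (Metric.mem_ball_self (mul_pos hu.1 h.radius_pos))

theorem dist_lineMap_lt {y : Fin n → ℝ} (hy : dist y b < r) {u : ℝ} (hu : 0 < u) :
    dist (AffineMap.lineMap a y u) (AffineMap.lineMap a b u) < u * r := by
  rw [dist_lineMap_lineMap_same_param, abs_of_pos hu]
  gcongr

theorem lineMap_mem (h : Ω.ContainsCone a b r) {y : Fin n → ℝ} (hy : dist y b < r) {u : ℝ}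
    (hu : u ∈ Ioc (0 : ℝ) 1) : AffineMap.lineMap a y u ∈ Ω.carrier :=
  h.ball_subset u hu (dist_lineMap_lt hy hu.1)

theorem subhypDist_le (h : Ω.ContainsCone a b r) (α : Ioc (0 : ℝ) 1) {s u : ℝ} (hs : 0 < s)
    (hsu : s ≤ u) (hu : u ≤ 1) :
    Ω.subhypDist α (AffineMap.lineMap a b s) (AffineMap.lineMap a b u) ≤
      dist a b * (r ^ ((α : ℝ) - 1) / α) * u ^ (α : ℝ) := by
  have hr := h.radius_pos
  have hα := α.2.1
  have hu0 : 0 ≤ u := hs.le.trans hsu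
  have hparam : ∀ v ∈ Icc s u, v ∈ Ioc (0 : ℝ) 1 := fun v hv =>
    ⟨hs.trans_le hv.1, hv.2.trans hu⟩
  have hpoint : ∀ v ∈ Icc s u,
      Metric.infEDist (AffineMap.lineMap a b v) (frontier Ω.carrier) ^ ((α : ℝ) - 1) ≤
        ENNReal.ofReal (r ^ ((α : ℝ) - 1)) * ENNReal.ofReal (v ^ ((α : ℝ) - 1)) := fun v hv => by
    have hv0 := (hparam v hv).1
    rw [← ENNReal.ofReal_mul (by positivity), mul_comm, ← Real.mul_rpow hv0.le hr.le]
    exact infEDist_rpow_le_of_ball_subset (mul_pos hv0 hr) (sub_nonpos.2 α.2.2)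
      (h.ball_subset v (hparam v hv))
  refine ENNReal.toReal_le_of_le_ofReal (by positivity) ?_
  calc _ ≤ ENNReal.ofReal (dist a b) * ∫⁻ v in Icc s u, ENNReal.ofReal (r ^ ((α : ℝ) - 1)) *
          ENNReal.ofReal (v ^ ((α : ℝ) - 1)) :=
        (subhypEDist_lineMap_le α hsu fun v hv => h.mem (hparam v hv)).trans
          (mul_le_mul_right (setLIntegral_mono' measurableSet_Icc hpoint) _)
    _ ≤ ENNReal.ofReal (dist a b) * ∫⁻ v in Ioc 0 u, ENNReal.ofReal (r ^ ((α : ℝ) - 1)) *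
          ENNReal.ofReal (v ^ ((α : ℝ) - 1)) := by
        gcongr
    _ = _ := by
        rw [lintegral_const_mul' _ _ ENNReal.ofReal_ne_top, lintegral_rpow_Ioc (by linarith) hu0,
          sub_add_cancel, ← ENNReal.ofReal_mul (by positivity),
          ← ENNReal.ofReal_mul dist_nonneg]
        ring_nf

end ContainsCone

/-- A constant `K` for which the points of parameter `u` on the axis of a cone with apex `a`, axis
from `a` to `b` and radius `r` are within `K * u ^ α` of the boundary element at the apex. -/
def coneConst (α : ℝ) (a b : Fin n → ℝ) (r : ℝ) : ℝ :=
  dist a b * (r ^ (α - 1) / α) + dist a b ^ α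

namespace ContainsCone

variable {a b : Fin n → ℝ} {r : ℝ}

theorem dist_le (h : Ω.ContainsCone a b r) {s u : ℝ} (hs : s ∈ Ioc (0 : ℝ) 1)
    (hu : u ∈ Ioc (0 : ℝ) 1) (hsu : s ≤ u) :
    dist (toSubhyp α (h.mem hs)) (toSubhyp α (h.mem hu)) ≤ coneConst α a b r * u ^ (α : ℝ) := by
  have hα := α.2.1
  rw [Subhyp.dist_def, coneConst, add_mul, ← dist_eq_norm, ← Real.mul_rpow dist_nonneg hu.1.le]
  refine add_le_add (h.subhypDist_le α hs.1 hsu hu.2) ?_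
  rw [pt_toSubhyp, pt_toSubhyp, dist_lineMap_lineMap, Real.dist_eq, mul_comm (dist a b),
    abs_sub_comm, abs_of_nonneg (sub_nonneg.2 hsu)]
  gcongr
  exact sub_le_self u hs.1.le

theorem exists_limit (α : Ioc (0 : ℝ) 1) (h : Ω.ContainsCone a b r) :
    ∃ ω : Ω.SubhypCompletion α, Ω.limitPoint α ω = a ∧ ∀ u (hu : u ∈ Ioc (0 : ℝ) 1),
      dist (toSubhyp α (h.mem hu) : Ω.SubhypCompletion α) ω ≤
        coneConst α a b r * u ^ (α : ℝ) := by
  have ht := one_div_natCast_add_one_mem_Ioc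
  have ht0 := tendsto_one_div_add_atTop_nhds_zero_nat (𝕜 := ℝ)
  have hrate : Tendsto (fun k : ℕ => coneConst α a b r * (1 / ((k : ℝ) + 1)) ^ (α : ℝ)) atTop
      (𝓝 0) := by
    simpa [Real.zero_rpow α.2.1.ne'] using
      (ht0.rpow_const (p := (α : ℝ)) (Or.inr α.2.1.le)).const_mul (coneConst α a b r)
  have hcauchy : CauchySeq fun k => (toSubhyp α (h.mem (ht k)) : Ω.SubhypCompletion α) :=
    cauchySeq_of_le_tendsto_0' _ (fun i j hij => by
      rw [Completion.dist_eq, dist_comm]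
      exact h.dist_le (ht j) (ht i) (Nat.one_div_le_one_div hij)) hrate
  obtain ⟨ω, hω⟩ := cauchySeq_tendsto_of_complete hcauchy
  refine ⟨ω, ?_, fun u hu => le_of_tendsto (tendsto_const_nhds.dist hω) ?_⟩
  · have hlimit := (continuous_limitPoint.tendsto ω).comp hω
    simp only [Function.comp_def, limitPoint_coe, pt_toSubhyp] at hlimit
    have hline : Continuous (AffineMap.lineMap a b : ℝ → Fin n → ℝ) := AffineMap.lineMap_continuous
    refine tendsto_nhds_unique hlimit ?_
    simpa [Function.comp_def] using (hline.tendsto 0).comp ht0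
  · filter_upwards [ht0.eventually (gt_mem_nhds hu.1)] with k hk
    rw [Completion.dist_eq, dist_comm]
    exact h.dist_le (ht k) hu hk.le

theorem dist_lineMap_le (h : Ω.ContainsCone a b r) {y : Fin n → ℝ} (hy : dist y b < r) {u : ℝ}
    (hu : u ∈ Ioc (0 : ℝ) 1) :
    dist (toSubhyp α (h.lineMap_mem hy hu)) (toSubhyp α (h.mem hu)) ≤
      (dist y b * (r - dist y b) ^ ((α : ℝ) - 1) + dist y b ^ (α : ℝ)) * u ^ (α : ℝ) := by
  have hu0 := hu.1
  have hρ : 0 < r - dist y b := sub_pos.2 hy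
  rw [Subhyp.dist_def, ← dist_eq_norm]
  refine (add_le_add_left (subhypDist_le_of_ball_subset α.2.2 (h.ball_subset u hu)
    (dist_lineMap_lt hy hu0)) _).trans_eq ?_
  simp only [pt_toSubhyp, dist_lineMap_lineMap_same_param, abs_of_pos hu0]
  rw [← mul_sub, Real.mul_rpow hu0.le hρ.le, Real.mul_rpow hu0.le dist_nonneg,
    Real.rpow_sub_one hu0.ne']
  field_simp

theorem isAlphaVisible (h : Ω.ContainsCone a b r) {ω : Ω.SubhypCompletion α}
    (hωa : Ω.limitPoint α ω = a) (hω : ∀ u (hu : u ∈ Ioc (0 : ℝ) 1),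
      dist (toSubhyp α (h.mem hu) : Ω.SubhypCompletion α) ω ≤ coneConst α a b r * u ^ (α : ℝ))
    {Q : AxisCube n} (hQ : Q.toSet ⊆ Metric.ball b r) : Ω.IsAlphaVisible α Q ω := by
  have hcenter : dist Q.center b < r := hQ (Metric.mem_closedBall_self Q.radius_pos.le)
  have ht := one_div_natCast_add_one_mem_Ioc
  refine ⟨⟨limitPoint_mem_closure ω, ?_⟩,
    fun k => toSubhyp α (h.lineMap_mem hcenter (ht k)), fun k => ⟨_, ht k, by rw [hωa]; rfl⟩, ?_⟩
  · rintro y hy _ ⟨u, hu, rfl⟩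
    exact hωa ▸ h.lineMap_mem (hQ hy) hu
  · exact tendsto_of_dist_le_mul_rpow α.2.1 tendsto_one_div_add_atTop_nhds_zero_nat fun k => calc
      dist (toSubhyp α (h.lineMap_mem hcenter (ht k)) : Ω.SubhypCompletion α) ω
        ≤ _ + _ := dist_triangle _ (toSubhyp α (h.mem (ht k)) : Ω.SubhypCompletion α) _
      _ ≤ _ + _ := add_le_add
          ((Completion.dist_eq _ _).trans_le (h.dist_lineMap_le hcenter (ht k))) (hω _ (ht k))
      _ = _ := (add_mul ..).symm

end ContainsCone

theorem IsVisible.containsCone {Q : AxisCube n} {a : Fin n → ℝ} (h : Ω.IsVisible Q a) :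
    Ω.ContainsCone a Q.center Q.radius := by
  refine ⟨Q.radius_pos, fun u hu z hz => h.2 (AffineMap.lineMap a z u⁻¹) ?_ ⟨u, hu, ?_⟩⟩
  · have hcenter : AffineMap.lineMap a (AffineMap.lineMap a Q.center u) u⁻¹ = Q.center := by
      rw [AffineMap.lineMap_lineMap_right, inv_mul_cancel₀ hu.1.ne', AffineMap.lineMap_apply_one]
    refine Metric.mem_closedBall.2 ?_
    rw [← hcenter, dist_lineMap_lineMap_same_param, abs_of_pos (inv_pos.2 hu.1),
      inv_mul_le_iff₀ hu.1]
    exact (Metric.mem_ball.1 hz).le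
  · rw [AffineMap.lineMap_lineMap_right, mul_inv_cancel₀ hu.1.ne', AffineMap.lineMap_apply_one]

theorem IsAlphaVisible.dist_le {Q : AxisCube n} {ω : Ω.SubhypCompletion α}
    (hω : ω ∈ Ω.alphaBoundary α) (h : Ω.IsAlphaVisible α Q ω) {u : ℝ} (hu : u ∈ Ioc (0 : ℝ) 1) :
    dist (toSubhyp α (h.1.containsCone.mem hu) : Ω.SubhypCompletion α) ω ≤
      coneConst α (Ω.limitPoint α ω) Q.center Q.radius * u ^ (α : ℝ) := by
  have hcone := h.1.containsCone
  obtain ⟨ω', -, hω'⟩ := hcone.exists_limit α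
  obtain ⟨y, hy, hyω⟩ := h.2
  choose t ht hty using hy
  have hyt : ∀ i, y i = toSubhyp α (hcone.mem (ht i)) := fun i => Subtype.ext (hty i).symm
  have hapex : Ω.limitPoint α ω ≠ Q.center := fun heq => by
    have hfrontier := mem_alphaBoundary_iff.1 hω
    rw [Ω.isOpen.frontier_eq, heq] at hfrontier
    exact hfrontier.2 (by simpa using hcone.mem (right_mem_Ioc.2 one_pos))
  have ht0 : Tendsto t atTop (𝓝 0) := by
    have hlimit := (continuous_limitPoint.tendsto ω).comp hyω
    rw [tendsto_iff_dist_tendsto_zero] at hlimit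
    simpa [Function.comp_def, limitPoint_coe, hyt, dist_lineMap_left, abs_of_pos (ht _).1,
      hapex, mul_div_cancel_right₀] using
      hlimit.div_const (dist (Ω.limitPoint α ω) Q.center)
  have hyω' : Tendsto (fun i => (y i : Ω.SubhypCompletion α)) atTop (𝓝 ω') :=
    tendsto_of_dist_le_mul_rpow α.2.1 ht0 fun i => hyt i ▸ hω' _ (ht i)
  exact tendsto_nhds_unique hyω' hyω ▸ hω' u hu

theorem IsTrace.tendsto_of_isAlphaVisible {F : (Fin n → ℝ) → ℝ} {f : Ω.alphaBoundary α → ℝ}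
    (hF : Ω.IsTrace α F f) {Q : AxisCube n} {ω : Ω.alphaBoundary α}
    (h : Ω.IsAlphaVisible α Q ω) {ι : Type*} {l : Filter ι} {t : ι → ℝ}
    (ht : ∀ k, t k ∈ Ioc (0 : ℝ) 1) (ht0 : Tendsto t l (𝓝 0)) :
    Tendsto (fun k => F (AffineMap.lineMap (Ω.limitPoint α ω) Q.center (t k))) l (𝓝 (f ω)) :=
  (hF ω).comp (f := fun k => toSubhyp α (h.1.containsCone.mem (ht k))) <|
    tendsto_comap_iff.2 (tendsto_of_dist_le_mul_rpow α.2.1 ht0 fun k => h.dist_le ω.2 (ht k))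

theorem IsTrace.isSubhypContinuous {F : (Fin n → ℝ) → ℝ} {f : Ω.alphaBoundary α → ℝ}
    (hF : Ω.IsTrace α F f) : Ω.IsSubhypContinuous α f := by
  intro ω ε hε
  obtain ⟨U, hU, hUF⟩ := mem_comap.1 (hF ω (Metric.closedBall_mem_nhds (f ω) (half_pos hε)))
  obtain ⟨δ, hδ, hδU⟩ := Metric.mem_nhds_iff.1 hU
  refine ⟨δ / 2, half_pos hδ, fun ω' hω' => ?_⟩
  have hdist : dist (ω' : Ω.SubhypCompletion α) ω < δ := by
    rw [dist_comm, dist_eq_closureDist_add]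
    linarith [dist_limitPoint_rpow_le ω.2 ω'.1]
  have hneBot : (comap ((↑) : Ω.Subhyp α → Ω.SubhypCompletion α)
      (𝓝 (ω' : Ω.SubhypCompletion α))).NeBot :=
    Completion.isDenseInducing_coe.comap_nhds_neBot _
  have hclosed : f ω' ∈ Metric.closedBall (f ω) (ε / 2) := by
    refine Metric.isClosed_closedBall.mem_of_tendsto (hF ω') ?_
    filter_upwards [preimage_mem_comap (Metric.isOpen_ball.mem_nhds hdist)] with x hx
    exact hUF (hδU hx)
  exact (Metric.mem_closedBall.1 hclosed).trans_lt (half_lt_self hε)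

/-- The distance to the complement of `Ω`. -/
def bdist (Ω : SpaceDomain n) (x : Fin n → ℝ) : ℝ :=
  Metric.infDist x Ω.carrierᶜ

theorem bdist_pos (hne : Ω.carrierᶜ.Nonempty) {x : Fin n → ℝ} (hx : x ∈ Ω.carrier) :
    0 < Ω.bdist x :=
  (Ω.isOpen.isClosed_compl.notMem_iff_infDist_pos hne).1 fun h => h hx

theorem ball_bdist_subset (x : Fin n → ℝ) : Metric.ball x (Ω.bdist x) ⊆ Ω.carrier :=
  disjoint_compl_right_iff_subset.1 Metric.disjoint_ball_infDist

theorem bdist_le_add_dist (x y : Fin n → ℝ) : Ω.bdist x ≤ Ω.bdist y + dist x y :=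
  Metric.infDist_le_infDist_add_dist

theorem bdist_le_dist_of_mem_frontier {a : Fin n → ℝ} (ha : a ∈ frontier Ω.carrier)
    (x : Fin n → ℝ) : Ω.bdist x ≤ dist x a := by
  rw [Ω.isOpen.frontier_eq] at ha
  exact Metric.infDist_le_dist_of_mem ha.2

theorem exists_nearest_boundary_element (α : Ioc (0 : ℝ) 1) (hne : Ω.carrierᶜ.Nonempty)
    {x : Fin n → ℝ} (hx : x ∈ Ω.carrier) :
    ∃ ω : Ω.alphaBoundary α, dist x (Ω.limitPoint α ω) = Ω.bdist x ∧
      dist (toSubhyp α hx : Ω.SubhypCompletion α) ω ≤ (1 / α + 1) * Ω.bdist x ^ (α : ℝ) ∧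
      ∀ Q : AxisCube n, Q.toSet ⊆ Metric.ball x (Ω.bdist x) → Ω.IsAlphaVisible α Q ω := by
  have hd := bdist_pos hne hx
  obtain ⟨a, haΩ, hxa⟩ := Ω.isOpen.isClosed_compl.exists_infDist_eq_dist hne x
  have hax : dist a x = Ω.bdist x := dist_comm x a ▸ hxa.symm
  have hcone : Ω.ContainsCone a x (Ω.bdist x) := by
    refine ⟨hd, fun u hu => (Metric.ball_subset_ball' ?_).trans (ball_bdist_subset x)⟩
    rw [dist_lineMap_right, Real.norm_of_nonneg (sub_nonneg.2 hu.2), hax]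
    linarith
  have hconst : coneConst α a x (Ω.bdist x) = (1 / α + 1) * Ω.bdist x ^ (α : ℝ) := by
    rw [coneConst, hax, Real.rpow_sub_one hd.ne']
    field_simp
  obtain ⟨ω, hωa, hω⟩ := hcone.exists_limit α
  have hωb : ω ∈ Ω.alphaBoundary α := by
    rw [mem_alphaBoundary_iff, Ω.isOpen.frontier_eq]
    exact ⟨limitPoint_mem_closure ω, hωa ▸ haΩ⟩
  refine ⟨⟨ω, hωb⟩, hωa ▸ hxa.symm, ?_, fun Q => hcone.isAlphaVisible hωa hω⟩
  simpa [hconst] using hω 1 (right_mem_Ioc.2 one_pos)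

end SpaceDomain

/-! ### Necessity: traces of Sobolev functions -/

theorem card_le_of_pairwise_lt_dist {n : ℕ} {ι : Type*} (s : Finset ι) (x : ι → Fin n → ℝ)
    (z : Fin n → ℝ) {ρ R : ℝ} (hρ : 0 < ρ) (hR : 0 ≤ R)
    (hsep : ∀ i ∈ s, ∀ j ∈ s, i ≠ j → 2 * ρ < dist (x i) (x j))
    (hz : ∀ i ∈ s, dist (x i) z ≤ R * ρ) : (s.card : ℝ) ≤ (R + 1) ^ n := by
  have hdisj : (s : Set ι).PairwiseDisjoint fun i => Metric.closedBall (x i) ρ :=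
    fun i hi j hj hij => Metric.closedBall_disjoint_closedBall (by linarith [hsep i hi j hj hij])
  have hsub : (⋃ i ∈ s, Metric.closedBall (x i) ρ) ⊆ Metric.closedBall z ((R + 1) * ρ) :=
    iUnion₂_subset fun i hi => Metric.closedBall_subset_closedBall' (by linarith [hz i hi])
  have hvol := measure_mono (μ := volume) hsub
  rw [measure_biUnion_finset hdisj fun _ _ => measurableSet_closedBall,
    Real.volume_pi_closedBall z (by positivity)] at hvol
  simp only [Real.volume_pi_closedBall _ hρ.le, Finset.sum_const, Fintype.card_fin,
    nsmul_eq_mul] at hvol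
  rw [← ENNReal.ofReal_natCast, ← ENNReal.ofReal_mul (by positivity),
    ENNReal.ofReal_le_ofReal_iff (by positivity), mul_left_comm, mul_pow (R + 1)] at hvol
  exact le_of_mul_le_mul_right hvol (by positivity)

theorem sum_setLIntegral_le_of_card_le {X ι : Type*} [MeasurableSpace X] {μ : Measure X}
    [Fintype ι] {B : ι → Set X} {A : Set X} {N : ℝ≥0∞} {h : X → ℝ≥0∞}
    (hB : ∀ i, MeasurableSet (B i)) (hBA : ∀ i, B i ⊆ A)
    (hcard : ∀ z (s : Finset ι), (∀ i ∈ s, z ∈ B i) → (s.card : ℝ≥0∞) ≤ N)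
    (hh : AEMeasurable h (μ.restrict A)) :
    ∑ i, ∫⁻ z in B i, h z ∂μ ≤ N * ∫⁻ z in A, h z ∂μ := by
  classical
  have hindicator : ∀ i, ∫⁻ z in B i, h z ∂μ = ∫⁻ z in A, (B i).indicator h z ∂μ := fun i => by
    rw [lintegral_indicator (hB i), Measure.restrict_restrict (hB i), inter_eq_left.2 (hBA i)]
  rw [Finset.sum_congr rfl fun i _ => hindicator i,
    ← lintegral_finsetSum' _ fun i _ => hh.indicator (hB i), ← lintegral_const_mul'' _ hh]
  refine lintegral_mono fun z => ?_
  simp only [indicator_apply, ← Finset.sum_filter, Finset.sum_const, nsmul_eq_mul]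
  gcongr
  exact hcard z _ fun i hi => (Finset.mem_filter.1 hi).2

theorem edist_rpow_le_of_geometric {X : Type*} [PseudoEMetricSpace X] {p : ℝ} (hp : 0 < p)
    {q : ℝ≥0∞} {b : ℕ → ℝ≥0∞} {v : ℕ → X} {x : X} (hv : Tendsto v atTop (𝓝 x))
    (h : ∀ k, edist (v k) (v (k + 1)) ^ p ≤ q ^ k * b k) :
    edist (v 0) x ^ p ≤ ((1 - q ^ (1 / p))⁻¹) ^ p * ∑' k, b k := by
  set S := ∑' k, b k
  have hstep : ∀ k, edist (v k) (v (k + 1)) ≤ (q ^ (1 / p)) ^ k * S ^ (1 / p) := fun k => by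
    have hpow : (q ^ (1 / p)) ^ k = (q ^ k) ^ (1 / p) := by
      simp_rw [← ENNReal.rpow_natCast, ← ENNReal.rpow_mul, mul_comm]
    rw [hpow, ← ENNReal.mul_rpow_of_nonneg _ _ (by positivity), one_div,
      ENNReal.le_rpow_inv_iff hp]
    exact (h k).trans (by gcongr; exact ENNReal.le_tsum k)
  have hsum : edist (v 0) x ≤ (1 - q ^ (1 / p))⁻¹ * S ^ (1 / p) := by
    rw [← ENNReal.tsum_geometric, ← ENNReal.tsum_mul_right]
    exact edist_le_tsum_of_edist_le_of_tendsto₀ _ hstep hv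
  refine (ENNReal.rpow_le_rpow hsum hp.le).trans_eq ?_
  rw [ENNReal.mul_rpow_of_nonneg _ _ hp.le, ← ENNReal.rpow_mul, one_div_mul_cancel hp.ne',
    ENNReal.rpow_one]

namespace SpaceDomain

variable {n : ℕ} {Ω : SpaceDomain n} {α : Ioc (0 : ℝ) 1} {p η u r r' : ℝ}
  {a a' b b' z : Fin n → ℝ}

theorem ContainsCone.closedBall_subset (h : Ω.ContainsCone a b r) (hu : u ∈ Ioc (0 : ℝ) 1) :
    Metric.closedBall (AffineMap.lineMap a b u) (u * r / 2) ⊆ Ω.carrier :=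
  (Metric.closedBall_subset_ball (half_lt_self (mul_pos hu.1 h.radius_pos))).trans
    (h.ball_subset u hu)

theorem ContainsCone.radius_le (h : Ω.ContainsCone a b r) (ha' : a' ∉ Ω.carrier)
    (hab' : dist a' b' ≤ η * r') (hu : u ∈ Ioc (0 : ℝ) 1)
    (hz : z ∈ Metric.closedBall (AffineMap.lineMap a b u) (u * r / 2))
    (hz' : z ∈ Metric.closedBall (AffineMap.lineMap a' b' u) (u * r' / 2)) :
    r ≤ (1 + 2 * η) * r' := by
  rw [Metric.mem_closedBall] at hz hz'
  have hlower : u * r / 2 ≤ dist a' z := by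
    by_contra! hlt
    refine ha' (h.ball_subset u hu (Metric.mem_ball.2 ?_))
    linarith [dist_triangle a' z (AffineMap.lineMap a b u)]
  have haxis : dist a' (AffineMap.lineMap a' b' u) ≤ u * (η * r') := by
    rw [dist_left_lineMap, Real.norm_of_nonneg hu.1.le]
    exact mul_le_mul_of_nonneg_left hab' hu.1.le
  refine le_of_mul_le_mul_left ?_ hu.1
  linarith [dist_triangle_right a' z (AffineMap.lineMap a' b' u)]

theorem dist_le_of_mem_closedBall_lineMap (hr : 0 ≤ r) (hη : 0 ≤ η) (hab : dist a b ≤ η * r)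
    (hu : u ∈ Ioc (0 : ℝ) 1)
    (hz : z ∈ Metric.closedBall (AffineMap.lineMap a b u) (u * r / 2)) :
    dist b z ≤ (η + 1) * r := by
  have haxis : dist b (AffineMap.lineMap a b u) ≤ (1 - u) * (η * r) := by
    rw [dist_right_lineMap, Real.norm_of_nonneg (sub_nonneg.2 hu.2)]
    exact mul_le_mul_of_nonneg_left hab (sub_nonneg.2 hu.2)
  have hηr : 0 ≤ u * (η * r) := mul_nonneg hu.1.le (mul_nonneg hη hr)
  have hur : u * r ≤ r := mul_le_of_le_one_left hr hu.2
  linarith [dist_triangle b (AffineMap.lineMap a b u) z, Metric.mem_closedBall'.1 hz]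

/-- A bound for the overlap of the balls at one level of the cones from disjoint cubes `Q` to
points of `η Q` outside `Ω`. -/
def overlapConst (n : ℕ) (η : ℝ) : ℝ :=
  ((η + 1) * (1 + 2 * η) ^ 2 + 1) ^ n

theorem card_cone_ball_le {ι : Type*} {Q : ι → AxisCube n} {a : ι → Fin n → ℝ}
    (hdisj : Pairwise fun i j => Disjoint (Q i).toSet (Q j).toSet) (hη : 0 ≤ η)
    (hcone : ∀ i, Ω.ContainsCone (a i) (Q i).center (Q i).radius) (ha : ∀ i, a i ∉ Ω.carrier)
    (hdist : ∀ i, a i ∈ (Q i).dilate η) (hu : u ∈ Ioc (0 : ℝ) 1) (s : Finset ι)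
    (hs : ∀ i ∈ s, z ∈ Metric.closedBall (AffineMap.lineMap (a i) (Q i).center u)
      (u * (Q i).radius / 2)) :
    (s.card : ℝ) ≤ overlapConst n η := by
  have hη' : 0 < 1 + 2 * η := by linarith
  have hcmp : ∀ i ∈ s, ∀ j ∈ s, (Q i).radius ≤ (1 + 2 * η) * (Q j).radius := fun i hi j hj =>
    (hcone i).radius_le (ha j) (hdist j) hu (hs i hi) (hs j hj)
  rcases s.eq_empty_or_nonempty with rfl | ⟨i₀, hi₀⟩
  · simp only [Finset.card_empty, Nat.cast_zero, overlapConst]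
    positivity
  refine card_le_of_pairwise_lt_dist s (fun i => (Q i).center) z
    (ρ := (Q i₀).radius / (1 + 2 * η)) (div_pos (Q i₀).radius_pos hη') (by positivity) ?_ ?_
  · intro i hi j hj hij
    have hsep := (disjoint_closedBall_closedBall_iff (Q i).radius_pos.le (Q j).radius_pos.le).1
      (hdisj hij)
    linarith [(div_le_iff₀' hη').2 (hcmp i₀ hi₀ i hi), (div_le_iff₀' hη').2 (hcmp i₀ hi₀ j hj)]
  · intro i hi
    calc dist (Q i).center z ≤ (η + 1) * (Q i).radius :=
          dist_le_of_mem_closedBall_lineMap (Q i).radius_pos.le hη (hdist i) hu (hs i hi)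
      _ ≤ (η + 1) * ((1 + 2 * η) * (Q i₀).radius) := by gcongr; exact hcmp i hi i₀ hi₀
      _ = _ := by field_simp

/-- The parameters of the points along which a function is followed to the apex of a cone from a
cube `Q` to a point of `η Q` are the powers of this number: consecutive points then lie in a ball
of the cone to which Morrey's inequality applies. -/
def coneStep (η : ℝ) : ℝ :=
  1 - 1 / (4 * η)

theorem coneStep_mem_Ioo (hη : 1 ≤ η) : coneStep η ∈ Ioo (0 : ℝ) 1 := by
  have hpos : 0 < 1 / (4 * η) := by positivity
  have hle : 1 / (4 * η) ≤ 1 / 4 := one_div_le_one_div_of_le (by norm_num) (by linarith)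
  constructor <;> rw [coneStep] <;> linarith

theorem coneStep_pow_mem_Ioc (hη : 1 ≤ η) (k : ℕ) : coneStep η ^ k ∈ Ioc (0 : ℝ) 1 :=
  ⟨pow_pos (coneStep_mem_Ioo hη).1 k,
    pow_le_one₀ (coneStep_mem_Ioo hη).1.le (coneStep_mem_Ioo hη).2.le⟩

/-- The ratio of the geometric series in the estimate of the trace along a cone. -/
def coneRatio (n : ℕ) (p η : ℝ) : ℝ≥0∞ :=
  ENNReal.ofReal (coneStep η ^ ((p - n) / 2))

theorem coneRatio_lt_one (hη : 1 ≤ η) (hp : n < p) : coneRatio n p η < 1 :=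
  ENNReal.ofReal_lt_one.2 <|
    Real.rpow_lt_one (coneStep_mem_Ioo hη).1.le (coneStep_mem_Ioo hη).2 (by linarith)

theorem ofReal_coneStep_pow_rpow (hη : 1 ≤ η) (k : ℕ) :
    ENNReal.ofReal ((coneStep η ^ k) ^ (p - n)) = coneRatio n p η ^ k * coneRatio n p η ^ k := by
  have ht := (coneStep_mem_Ioo hη).1
  rw [coneRatio, ← mul_pow, ← ENNReal.ofReal_mul (by positivity), ← Real.rpow_add ht, add_halves,
    ← ENNReal.ofReal_pow (by positivity), Real.rpow_pow_comm ht.le]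

variable {F : (Fin n → ℝ) → ℝ} {g : (Fin n → ℝ) → Fin n → ℝ}

theorem IsSobolevWith.setLIntegral_ne_top (h : Ω.IsSobolevWith p F g) (hp : 0 < p) :
    ∫⁻ z in Ω.carrier, ‖g z‖ₑ ^ p ≠ ⊤ := by
  have hfin := lintegral_rpow_enorm_lt_top_of_eLpNorm_lt_top (by simpa using hp)
    ENNReal.ofReal_ne_top h.memLp.2
  rw [ENNReal.toReal_ofReal hp.le] at hfin
  exact hfin.ne

theorem IsSobolevWith.edist_lineMap_rpow_le (h : Ω.IsSobolevWith p F g) (hp1 : 1 ≤ p)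
    (hp : n < p) (hη : 0 < η) (hcone : Ω.ContainsCone a b r) (hab : dist a b ≤ η * r)
    (hu : u ∈ Ioc (0 : ℝ) 1) :
    edist (F (AffineMap.lineMap a b u)) (F (AffineMap.lineMap a b (u * coneStep η))) ^ p ≤
      ENNReal.ofReal (u ^ (p - n)) * (ENNReal.ofReal (morreyConst n p * (1 / 4) ^ (p - n)) *
        (n : ℝ≥0∞) ^ p * ENNReal.ofReal (r ^ (p - n)) *
        ∫⁻ z in Metric.closedBall (AffineMap.lineMap a b u) (u * r / 2), ‖g z‖ₑ ^ p) := by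
  have hr := hcone.radius_pos
  have hu0 := hu.1
  have hC := morreyConst_nonneg hp
  have hmem : AffineMap.lineMap a b (u * coneStep η) ∈
      Metric.closedBall (AffineMap.lineMap a b u) (u * r / 2 / 2) := by
    have hstep : u - u * coneStep η = u * (1 / (4 * η)) := by rw [coneStep]; ring
    rw [Metric.mem_closedBall', dist_lineMap_lineMap, Real.dist_eq, hstep,
      abs_of_pos (by positivity)]
    calc u * (1 / (4 * η)) * dist a b ≤ u * (1 / (4 * η)) * (η * r) := by gcongr
      _ = u * r / 2 / 2 := by field_simp; norm_num
  have hmorrey := h.enorm_sub_rpow_le hp1 hp (by positivity) (hcone.closedBall_subset hu)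
    (Metric.mem_closedBall_self (by positivity)) hmem
  have hscale : morreyConst n p * (u * r / 2 / 2) ^ (p - n) =
      u ^ (p - n) * (morreyConst n p * (1 / 4) ^ (p - n)) * r ^ (p - n) := by
    rw [show u * r / 2 / 2 = u * (1 / 4) * r by ring, Real.mul_rpow (by positivity) hr.le,
      Real.mul_rpow hu0.le (by norm_num)]
    ring
  rw [hscale, ENNReal.ofReal_mul (by positivity), ENNReal.ofReal_mul (by positivity)] at hmorrey
  rw [edist_eq_enorm_sub]
  exact hmorrey.trans_eq (by ring)

/-- The constant in the estimate of the trace of a Sobolev function along one cone. -/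
def coneTraceConst (n : ℕ) (p η : ℝ) : ℝ≥0∞ :=
  ((1 - coneRatio n p η ^ (1 / p))⁻¹) ^ p *
    (ENNReal.ofReal (morreyConst n p * (1 / 4) ^ (p - n)) * (n : ℝ≥0∞) ^ p)

theorem IsTrace.edist_rpow_le {f : Ω.alphaBoundary α → ℝ} (hF : Ω.IsTrace α F f)
    (h : Ω.IsSobolevWith p F g) (hp1 : 1 ≤ p) (hp : n < p) (hη : 1 ≤ η) {Q : AxisCube n}
    {ω : Ω.alphaBoundary α} (hvis : Ω.IsAlphaVisible α Q ω)
    (hω : Ω.limitPoint α ω ∈ Q.dilate η) :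
    edist (F Q.center) (f ω) ^ p ≤ coneTraceConst n p η * ENNReal.ofReal (Q.radius ^ (p - n)) *
      ∑' k : ℕ, coneRatio n p η ^ k * ∫⁻ z in
        Metric.closedBall (AffineMap.lineMap (Ω.limitPoint α ω) Q.center (coneStep η ^ k))
          (coneStep η ^ k * Q.radius / 2), ‖g z‖ₑ ^ p := by
  have ht := coneStep_mem_Ioo hη
  have htk := coneStep_pow_mem_Ioc hη
  have hlim := hF.tendsto_of_isAlphaVisible hvis htk
    (tendsto_pow_atTop_nhds_zero_of_lt_one ht.1.le ht.2)
  have hgeometric := edist_rpow_le_of_geometric (p := p) (by linarith) hlim fun k => by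
    rw [pow_succ]
    refine (h.edist_lineMap_rpow_le hp1 hp (by linarith) hvis.1.containsCone hω
      (htk k)).trans_eq ?_
    rw [ofReal_coneStep_pow_rpow hη, mul_assoc]
  simp only [pow_zero, AffineMap.lineMap_apply_one] at hgeometric
  refine hgeometric.trans_eq ?_
  simp_rw [mul_left_comm (coneRatio n p η ^ _), ENNReal.tsum_mul_left, coneTraceConst]
  ring

/-- The constant in the estimate of the trace of a Sobolev function along cones over disjoint
cubes. -/
def coneSumConst (n : ℕ) (p η : ℝ) : ℝ≥0∞ :=
  coneTraceConst n p η * ((1 - coneRatio n p η)⁻¹ * ENNReal.ofReal (overlapConst n η))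

theorem IsTrace.sum_edist_rpow_le {f : Ω.alphaBoundary α → ℝ} (hF : Ω.IsTrace α F f)
    (h : Ω.IsSobolevWith p F g) (hp1 : 1 ≤ p) (hp : n < p) (hη : 1 ≤ η) {ι : Type*} [Fintype ι]
    {Q : ι → AxisCube n} {ω : ι → Ω.alphaBoundary α}
    (hdisj : Pairwise fun i j => Disjoint (Q i).toSet (Q j).toSet)
    (hvis : ∀ i, Ω.IsAlphaVisible α (Q i) (ω i))
    (hω : ∀ i, Ω.limitPoint α (ω i) ∈ (Q i).dilate η) :
    ∑ i, edist (F (Q i).center) (f (ω i)) ^ p / ENNReal.ofReal ((Q i).radius ^ (p - n)) ≤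
      coneSumConst n p η * ∫⁻ z in Ω.carrier, ‖g z‖ₑ ^ p := by
  set B : ι → ℕ → Set (Fin n → ℝ) := fun i k =>
    Metric.closedBall (AffineMap.lineMap (Ω.limitPoint α (ω i)) (Q i).center (coneStep η ^ k))
      (coneStep η ^ k * (Q i).radius / 2) with hB
  have hcone := fun i => (hvis i).1.containsCone
  have hnotMem : ∀ i, Ω.limitPoint α (ω i) ∉ Ω.carrier := fun i => by
    have hfrontier := mem_alphaBoundary_iff.1 (ω i).2
    rw [Ω.isOpen.frontier_eq] at hfrontier
    exact hfrontier.2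
  have hlevel : ∀ k, ∑ i, ∫⁻ z in B i k, ‖g z‖ₑ ^ p ≤
      ENNReal.ofReal (overlapConst n η) * ∫⁻ z in Ω.carrier, ‖g z‖ₑ ^ p := fun k =>
    sum_setLIntegral_le_of_card_le (fun i => measurableSet_closedBall)
      (fun i => (hcone i).closedBall_subset (coneStep_pow_mem_Ioc hη k))
      (fun z s hs => by
        rw [← ENNReal.ofReal_natCast]
        exact ENNReal.ofReal_le_ofReal (card_cone_ball_le hdisj (by linarith) hcone hnotMem hω
          (coneStep_pow_mem_Ioc hη k) s hs))
      ((h.aemeasurable_enorm subset_rfl).pow_const p)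
  calc _ ≤ ∑ i, coneTraceConst n p η * ∑' k : ℕ, coneRatio n p η ^ k *
          ∫⁻ z in B i k, ‖g z‖ₑ ^ p := Finset.sum_le_sum fun i _ =>
        ENNReal.div_le_of_le_mul ((hF.edist_rpow_le h hp1 hp hη (hvis i) (hω i)).trans_eq
          (by rw [hB]; ring))
    _ = coneTraceConst n p η * ∑' k : ℕ, coneRatio n p η ^ k *
          ∑ i, ∫⁻ z in B i k, ‖g z‖ₑ ^ p := by
        rw [← Finset.mul_sum, ← Summable.tsum_finsetSum fun _ _ => ENNReal.summable]
        simp_rw [← Finset.mul_sum]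
    _ ≤ coneTraceConst n p η * ∑' k : ℕ, coneRatio n p η ^ k *
          (ENNReal.ofReal (overlapConst n η) * ∫⁻ z in Ω.carrier, ‖g z‖ₑ ^ p) := by
        gcongr with k
        exact hlevel k
    _ = _ := by
        rw [ENNReal.tsum_mul_right, ENNReal.tsum_geometric, coneSumConst]
        ring

/-- The constant in the variational inequality for the trace of a Sobolev function. -/
def variationConst (n : ℕ) (p η : ℝ) : ℝ≥0∞ :=
  2 ^ p * coneSumConst n p η

theorem variationConst_ne_top (hp0 : 0 < p) (hp : n < p) (hη : 1 ≤ η) :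
    variationConst n p η ≠ ⊤ := by
  have hq := coneRatio_lt_one hη hp
  have hq' : coneRatio n p η ^ (1 / p) < 1 := ENNReal.rpow_lt_one hq (by positivity)
  have hinv : ∀ x : ℝ≥0∞, x < 1 → (1 - x)⁻¹ ≠ ⊤ := fun x hx =>
    ENNReal.inv_ne_top.2 (tsub_pos_of_lt hx).ne'
  have hrpow : ∀ x : ℝ≥0∞, x ≠ ⊤ → x ^ p ≠ ⊤ := fun x hx => ENNReal.rpow_ne_top_of_nonneg hp0.le hx
  simp only [variationConst, coneSumConst, coneTraceConst]
  exact ENNReal.mul_ne_top (hrpow 2 ENNReal.ofNat_ne_top) <| ENNReal.mul_ne_top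
    (ENNReal.mul_ne_top (hrpow _ (hinv _ hq')) <|
      ENNReal.mul_ne_top ENNReal.ofReal_ne_top (hrpow n (ENNReal.natCast_ne_top n)))
    (ENNReal.mul_ne_top (hinv _ hq) ENNReal.ofReal_ne_top)

theorem IsTrace.variationBound {f : Ω.alphaBoundary α → ℝ} (hF : Ω.IsTrace α F f)
    (h : Ω.IsSobolevWith p F g) (hn : 1 ≤ n) (hp : n < p) (hη : 1 ≤ η) {lam : ℝ}
    (hlam0 : 0 ≤ lam)
    (hlam : variationConst n p η * ∫⁻ z in Ω.carrier, ‖g z‖ₑ ^ p ≤ ENNReal.ofReal lam) :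
    Ω.VariationBound p α η f lam := by
  have hp1 : 1 ≤ p := (Nat.one_le_cast.2 hn).trans hp.le
  intro m Q ω₁ ω₂ _ hdisj hvis hω
  have h₁ := hF.sum_edist_rpow_le h hp1 hp hη hdisj (fun i => (hvis i).1) fun i => (hω i).1.1
  have h₂ := hF.sum_edist_rpow_le h hp1 hp hη hdisj (fun i => (hvis i).2) fun i => (hω i).2.1
  have : Nonempty (Fin n) := ⟨⟨0, hn⟩⟩
  have hdiam : ∀ i, (Q i).radius ≤ Metric.diam (Q i).toSet := fun i => by
    rw [AxisCube.toSet, Metric.diam_closedBall_eq _ (Q i).radius_pos.le]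
    linarith [(Q i).radius_pos]
  have hterm : ∀ i,
      ENNReal.ofReal (|f (ω₁ i) - f (ω₂ i)| ^ p / Metric.diam (Q i).toSet ^ (p - n)) ≤
        2 ^ (p - 1) *
          (edist (F (Q i).center) (f (ω₁ i)) ^ p / ENNReal.ofReal ((Q i).radius ^ (p - n)) +
            edist (F (Q i).center) (f (ω₂ i)) ^ p / ENNReal.ofReal ((Q i).radius ^ (p - n))) :=
    fun i => by
    have hr := (Q i).radius_pos
    have hd := hr.trans_le (hdiam i)
    rw [ENNReal.ofReal_div_of_pos (by positivity), ← Real.dist_eq,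
      ← ENNReal.ofReal_rpow_of_nonneg dist_nonneg (by linarith), ← edist_dist,
      ← ENNReal.add_div, ← mul_div_assoc]
    refine ENNReal.div_le_div ?_ (ENNReal.ofReal_le_ofReal
      (Real.rpow_le_rpow hr.le (hdiam i) (by linarith)))
    exact (ENNReal.rpow_le_rpow (edist_triangle_left _ _ _) (by linarith)).trans
      (ENNReal.rpow_add_le_mul_rpow_add_rpow _ _ hp1)
  rw [← ENNReal.ofReal_le_ofReal_iff hlam0,
    ENNReal.ofReal_sum_of_nonneg fun i _ => by positivity]
  refine le_trans ?_ hlam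
  calc _ ≤ _ := Finset.sum_le_sum fun i _ => hterm i
    _ ≤ 2 ^ (p - 1) * (coneSumConst n p η * (∫⁻ z in Ω.carrier, ‖g z‖ₑ ^ p) +
          coneSumConst n p η * ∫⁻ z in Ω.carrier, ‖g z‖ₑ ^ p) := by
        rw [← Finset.mul_sum, Finset.sum_add_distrib]
        gcongr
    _ = 2 ^ (p - 1) * 2 * (coneSumConst n p η * ∫⁻ z in Ω.carrier, ‖g z‖ₑ ^ p) := by ring
    _ = variationConst n p η * ∫⁻ z in Ω.carrier, ‖g z‖ₑ ^ p := by
        rw [variationConst, ENNReal.rpow_sub _ _ two_ne_zero ENNReal.ofNat_ne_top,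
          ENNReal.rpow_one, ENNReal.div_mul_cancel two_ne_zero ENNReal.ofNat_ne_top, mul_assoc]

end SpaceDomain

/-! ### Sufficiency: extension by means of a Whitney net -/

theorem norm_centerMass_sub_centerMass_le {ι E : Type*} [NormedAddCommGroup E] [NormedSpace ℝ E]
    {T : Finset ι} {w w' : ι → ℝ} {v : ι → E} {c : E} {D : ℝ} (hw : ∀ i ∈ T, 0 ≤ w i)
    (hW : 0 < ∑ i ∈ T, w i) (hW' : 1 ≤ ∑ i ∈ T, w' i)
    (hv : ∀ i ∈ T, v i ∈ Metric.closedBall c D) :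
    ‖T.centerMass w' v - T.centerMass w v‖ ≤ 2 * D * ∑ i ∈ T, |w' i - w i| := by
  set m := T.centerMass w v with hm
  have hm_mem : m ∈ Metric.closedBall c D := (convex_closedBall c D).centerMass_mem hw hW hv
  have hmW : (∑ i ∈ T, w i) • m = ∑ i ∈ T, w i • v i := by
    rw [hm, Finset.centerMass, smul_inv_smul₀ hW.ne']
  have hdiff : T.centerMass w' v - m = (∑ i ∈ T, w' i)⁻¹ • ∑ i ∈ T, (w' i - w i) • (v i - m) := by
    rw [Finset.centerMass, eq_inv_smul_iff₀ (by linarith), smul_sub, smul_inv_smul₀ (by linarith)]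
    simp only [sub_smul, smul_sub, Finset.sum_sub_distrib, ← Finset.sum_smul, hmW]
    abel
  have hterm : ∀ i ∈ T, ‖(w' i - w i) • (v i - m)‖ ≤ 2 * D * |w' i - w i| := fun i hi => by
    rw [norm_smul, mul_comm, Real.norm_eq_abs, ← dist_eq_norm]
    refine mul_le_mul_of_nonneg_right ((dist_triangle_right _ _ c).trans ?_) (abs_nonneg _)
    linarith [Metric.mem_closedBall.1 (hv i hi), Metric.mem_closedBall.1 hm_mem]
  rw [hdiff, norm_smul, norm_inv, Real.norm_of_nonneg (by linarith), Finset.mul_sum]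
  exact (mul_le_of_le_one_left (norm_nonneg _) (inv_le_one_of_one_le₀ hW')).trans
    (norm_sum_le_of_le T hterm)

theorem exists_maximal_pairwise {X : Type*} (s : Set X) (r : X → X → Prop) :
    ∃ t, Maximal (fun t => t ⊆ s ∧ t.Pairwise r) t := by
  refine zorn_subset {t | t ⊆ s ∧ t.Pairwise r} fun c hc hchain =>
    ⟨⋃₀ c, ⟨sUnion_subset fun t ht => (hc ht).1, ?_⟩, fun t ht => subset_sUnion_of_mem ht⟩
  exact (pairwise_sUnion hchain.directedOn).2 fun t ht => (hc ht).2

/-- The gradient of `F` in coordinates: the vector of the partial derivatives of `F`. -/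
def coordGradient {n : ℕ} (F : (Fin n → ℝ) → ℝ) (x : Fin n → ℝ) (i : Fin n) : ℝ :=
  fderiv ℝ F x (Pi.single i 1)

theorem measurable_coordGradient {n : ℕ} (F : (Fin n → ℝ) → ℝ) : Measurable (coordGradient F) :=
  measurable_pi_lambda _ fun _ => measurable_fderiv_apply_const ℝ F _

theorem norm_coordGradient_le {n : ℕ} (F : (Fin n → ℝ) → ℝ) (x : Fin n → ℝ) :
    ‖coordGradient F x‖ ≤ ‖fderiv ℝ F x‖ := by
  refine (pi_norm_le_iff_of_nonneg (norm_nonneg _)).2 fun i => ?_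
  exact ((fderiv ℝ F x).le_opNorm _).trans_eq (by rw [Pi.norm_single, norm_one, mul_one])

/-- The bump function whose translated and rescaled copies generate the partitions of unity. -/
def whitneyBump (n : ℕ) : ContDiffBump (0 : Fin n → ℝ) :=
  ⟨1 / 9, 1 / 8, by norm_num, by norm_num⟩

theorem exists_lipschitzWith_whitneyBump (n : ℕ) : ∃ L, LipschitzWith L (whitneyBump n) :=
  ContDiff.lipschitzWith_of_hasCompactSupport (𝕂 := ℝ) (whitneyBump n).hasCompactSupport
    ((whitneyBump n).contDiff (n := 1)) one_ne_zero

/-- A Lipschitz constant of `whitneyBump n`. -/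
def whitneyBumpLipConst (n : ℕ) : NNReal :=
  (exists_lipschitzWith_whitneyBump n).choose

theorem lipschitzWith_whitneyBump (n : ℕ) : LipschitzWith (whitneyBumpLipConst n) (whitneyBump n) :=
  (exists_lipschitzWith_whitneyBump n).choose_spec

namespace SpaceDomain

variable {n : ℕ} {Ω : SpaceDomain n}

theorem isWeakGradient_of_contDiffOn {F : (Fin n → ℝ) → ℝ} (hF : ContDiffOn ℝ 1 F Ω.carrier) :
    Ω.IsWeakGradient F (coordGradient F) := by
  intro φ hφ hφc hφΩ i
  have hdφ : Function.support (fun x => fderiv ℝ φ x (Pi.single i 1)) ⊆ tsupport φ :=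
    fun x hx => support_fderiv_subset ℝ fun h0 => hx (by simp [h0])
  have hφ' : Function.support φ ⊆ tsupport φ := subset_tsupport φ
  have hdφ_cont : Continuous fun x => fderiv ℝ φ x (Pi.single i 1) :=
    (hφ.continuous_fderiv (by simp)).clm_apply continuous_const
  have hdF_cont : ContinuousOn (fun x => fderiv ℝ F x (Pi.single i 1)) Ω.carrier :=
    (hF.continuousOn_fderiv_of_isOpen Ω.isOpen le_rfl).clm_apply continuousOn_const
  have hint : ∀ {u ψ : (Fin n → ℝ) → ℝ}, ContinuousOn u Ω.carrier → Continuous ψ →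
      Function.support ψ ⊆ tsupport φ → Integrable fun x => u x * ψ x := fun hu hψ hsupp =>
    (integrableOn_iff_integrable_of_support_subset
      ((Function.support_mul_subset_right _ _).trans hsupp)).1
      (((hu.mono hφΩ).mul hψ.continuousOn).integrableOn_compact hφc)
  have hset : ∀ {u ψ : (Fin n → ℝ) → ℝ}, Function.support ψ ⊆ tsupport φ →
      ∫ x in Ω.carrier, u x * ψ x = ∫ x, u x * ψ x := fun hsupp =>
    setIntegral_eq_integral_of_forall_compl_eq_zero fun x hx => by
      rw [Function.notMem_support.1 fun h => hx (hφΩ (hsupp h)), mul_zero]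
  rw [hset hdφ, hset hφ']
  exact integral_mul_fderiv_eq_neg_fderiv_mul_of_integrable (hint hdF_cont hφ.continuous hφ')
    (hint hF.continuousOn hdφ_cont hdφ) (hint hF.continuousOn hφ.continuous hφ')
    (fun x hx => (hF.differentiableOn one_ne_zero).differentiableAt (Ω.isOpen.mem_nhds (hφΩ hx)))
    fun x _ => hφ.differentiable (by simp) x

/-- A set of points of `Ω` that is separated and dense in `Ω` at the scale of the distance to the
complement. The condition `bdist_pos` makes sense of this scale; it forces `Ω ≠ ℝⁿ`. -/
structure WhitneyNet (Ω : SpaceDomain n) where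
  /-- The points of the net. -/
  pts : Set (Fin n → ℝ)
  bdist_pos : ∀ j : pts, 0 < Ω.bdist j
  separated : pts.Pairwise fun x y => (Ω.bdist x + Ω.bdist y) / 20 < dist x y
  cover : ∀ x ∈ Ω.carrier, ∃ j : pts, dist x j ≤ Ω.bdist j / 9

theorem nonempty_whitneyNet (hne : Ω.carrierᶜ.Nonempty) : Nonempty Ω.WhitneyNet := by
  obtain ⟨J, hJ⟩ := exists_maximal_pairwise Ω.carrier
    fun x y => (Ω.bdist x + Ω.bdist y) / 20 < dist x y
  have hpos : ∀ x ∈ J, 0 < Ω.bdist x := fun x hx => SpaceDomain.bdist_pos hne (hJ.prop.1 hx)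
  refine ⟨⟨J, fun j => hpos j j.2, hJ.prop.2, fun x hx => ?_⟩⟩
  by_contra! hfar
  have hsep : ∀ y ∈ J, (Ω.bdist x + Ω.bdist y) / 20 < dist x y := fun y hy => by
    linarith [hfar ⟨y, hy⟩, Ω.bdist_le_add_dist x y, hpos y hy]
  have hsep' : ∀ y ∈ J, (Ω.bdist y + Ω.bdist x) / 20 < dist y x := fun y hy => by
    rw [dist_comm, add_comm]
    exact hsep y hy
  have hxJ : x ∈ J := hJ.le_of_ge
    ⟨insert_subset hx hJ.prop.1, hJ.prop.2.insert fun y hy _ => ⟨hsep y hy, hsep' y hy⟩⟩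
    (subset_insert x J) (mem_insert x J)
  linarith [hsep x hxJ, dist_self x, hpos x hxJ]

namespace WhitneyNet

variable {J : Ω.WhitneyNet} {i j : J.pts} {x : Fin n → ℝ} {v : J.pts → ℝ}

theorem mem_carrier (j : J.pts) : (j : Fin n → ℝ) ∈ Ω.carrier :=
  Ω.ball_bdist_subset j (Metric.mem_ball_self (J.bdist_pos j))

theorem lt_dist_of_ne (hij : i ≠ j) :
    (Ω.bdist i + Ω.bdist j) / 20 < dist (i : Fin n → ℝ) j :=
  J.separated i.2 j.2 (Subtype.coe_injective.ne hij)

theorem card_le_of_forall_dist_le (j : J.pts) (s : Finset J.pts)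
    (hs : ∀ i ∈ s, dist (i : Fin n → ℝ) j ≤ 2 / 7 * Ω.bdist j) : (s.card : ℝ) ≤ 9 ^ n := by
  have hj := J.bdist_pos j
  have hlow : ∀ i ∈ s, 5 / 7 * Ω.bdist j ≤ Ω.bdist i := fun i hi => by
    linarith [hs i hi, Ω.bdist_le_add_dist j i, dist_comm (i : Fin n → ℝ) j]
  calc (s.card : ℝ) ≤ (8 + 1) ^ n :=
        card_le_of_pairwise_lt_dist s (fun i => (i : Fin n → ℝ)) j (ρ := Ω.bdist j / 28)
          (by positivity) (by norm_num)
          (fun i hi i' hi' hii => by linarith [lt_dist_of_ne hii, hlow i hi, hlow i' hi'])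
          fun i hi => by linarith [hs i hi]
    _ = 9 ^ n := by norm_num

theorem finite_setOf_dist_le (j : J.pts) :
    {i : J.pts | dist (i : Fin n → ℝ) j ≤ 2 / 7 * Ω.bdist j}.Finite := by
  refine Set.not_infinite.1 fun hinf => ?_
  obtain ⟨s, hs, hcard⟩ := hinf.exists_subset_card_eq (9 ^ n + 1)
  have hle := card_le_of_forall_dist_le j s fun i hi => hs hi
  rw [hcard] at hle
  push_cast at hle
  linarith

/-- The neighbours of a point of the net: they include all the points whose bump functions meet the
support of the bump function of the given one. -/
def nbrs (j : J.pts) : Finset J.pts :=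
  (finite_setOf_dist_le j).toFinset

theorem mem_nbrs : i ∈ nbrs j ↔ dist (i : Fin n → ℝ) j ≤ 2 / 7 * Ω.bdist j :=
  (finite_setOf_dist_le j).mem_toFinset

theorem self_mem_nbrs (j : J.pts) : j ∈ nbrs j := by
  have hj := J.bdist_pos j
  rw [mem_nbrs, dist_self]
  positivity

theorem card_nbrs_le (j : J.pts) : ((nbrs j).card : ℝ) ≤ 9 ^ n :=
  card_le_of_forall_dist_le j _ fun _ => mem_nbrs.1

theorem le_bdist_of_mem_nbrs (h : i ∈ nbrs j) : 5 / 7 * Ω.bdist j ≤ Ω.bdist i := by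
  linarith [mem_nbrs.1 h, Ω.bdist_le_add_dist j i, dist_comm (i : Fin n → ℝ) j]

theorem bdist_le_of_mem_nbrs (h : i ∈ nbrs j) : Ω.bdist i ≤ 9 / 7 * Ω.bdist j := by
  linarith [mem_nbrs.1 h, Ω.bdist_le_add_dist i j]

theorem mem_nbrs_of_dist_lt (hi : dist x i < Ω.bdist i / 8) (hj : dist x j < Ω.bdist j / 8) :
    i ∈ nbrs j := by
  rw [mem_nbrs]
  linarith [Ω.bdist_le_add_dist i j, dist_triangle_left (i : Fin n → ℝ) j x]

theorem countable (J : Ω.WhitneyNet) : Countable J.pts := by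
  refine Set.PairwiseDisjoint.countable_of_isOpen (s := fun x => Metric.ball x (Ω.bdist x / 20))
    (a := J.pts) (fun x hx y hy hxy => ?_) (fun x _ => Metric.isOpen_ball)
    fun x hx => Metric.nonempty_ball.2 (by linarith [J.bdist_pos ⟨x, hx⟩])
  exact Metric.ball_disjoint_ball (by linarith [J.separated hx hy hxy])

/-- The bump function at a point of the net, at the scale of the distance to the complement. -/
def weight (j : J.pts) (x : Fin n → ℝ) : ℝ :=
  whitneyBump n ((Ω.bdist j)⁻¹ • (x - j))

theorem weight_nonneg (j : J.pts) (x : Fin n → ℝ) : 0 ≤ weight j x :=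
  (whitneyBump n).nonneg

theorem contDiff_weight (j : J.pts) : ContDiff ℝ 1 (weight j) :=
  (whitneyBump n).contDiff.comp ((contDiff_id.sub contDiff_const).const_smul _)

theorem norm_inv_bdist_smul_sub (j : J.pts) (x : Fin n → ℝ) :
    ‖(Ω.bdist j)⁻¹ • (x - j)‖ = dist x j / Ω.bdist j := by
  rw [norm_smul, norm_inv, Real.norm_of_nonneg (J.bdist_pos j).le, ← dist_eq_norm, inv_mul_eq_div]

theorem weight_eq_one (h : dist x j ≤ Ω.bdist j / 9) : weight j x = 1 := by
  refine (whitneyBump n).one_of_mem_closedBall (mem_closedBall_zero_iff.2 ?_)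
  rw [norm_inv_bdist_smul_sub, div_le_iff₀ (J.bdist_pos j)]
  change dist x j ≤ 1 / 9 * Ω.bdist j
  linarith

theorem dist_lt_of_weight_ne_zero (h : weight j x ≠ 0) : dist x j < Ω.bdist j / 8 := by
  have hsupp : (Ω.bdist j)⁻¹ • (x - j) ∈ Function.support (whitneyBump n) := h
  rw [(whitneyBump n).support_eq, mem_ball_zero_iff, norm_inv_bdist_smul_sub,
    div_lt_iff₀ (J.bdist_pos j)] at hsupp
  change dist x j < 1 / 8 * Ω.bdist j at hsupp
  linarith

theorem abs_weight_sub_le (j : J.pts) (x y : Fin n → ℝ) :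
    |weight j y - weight j x| ≤ whitneyBumpLipConst n / Ω.bdist j * ‖y - x‖ := by
  have h := (lipschitzWith_whitneyBump n).dist_le_mul ((Ω.bdist j)⁻¹ • (y - j))
    ((Ω.bdist j)⁻¹ • (x - j))
  rw [dist_smul₀, dist_sub_right, norm_inv, Real.norm_of_nonneg (J.bdist_pos j).le,
    dist_eq_norm y x, ← mul_assoc, ← div_eq_mul_inv] at h
  exact h

theorem one_le_sum_weight (hj : dist x j < Ω.bdist j / 8) : 1 ≤ ∑ i ∈ nbrs j, weight i x := by
  have hx : x ∈ Ω.carrier :=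
    Ω.ball_bdist_subset j (Metric.mem_ball.2 (by linarith [J.bdist_pos j]))
  obtain ⟨i, hi⟩ := J.cover x hx
  have hmem : i ∈ nbrs j := mem_nbrs_of_dist_lt (by linarith [J.bdist_pos i]) hj
  rw [← weight_eq_one hi]
  exact Finset.single_le_sum (fun i _ => weight_nonneg i x) hmem

theorem exists_dist_lt (J : Ω.WhitneyNet) (hx : x ∈ Ω.carrier) :
    ∃ j : J.pts, dist x j < Ω.bdist j / 8 := by
  obtain ⟨j, hj⟩ := J.cover x hx
  exact ⟨j, by linarith [J.bdist_pos j]⟩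

/-- The extension to `Ω` of a function on the net by means of the partition of unity obtained from
the bump functions. -/
def extend (v : J.pts → ℝ) (x : Fin n → ℝ) : ℝ :=
  (∑ᶠ i : J.pts, weight i x)⁻¹ * ∑ᶠ i, weight i x * v i

theorem extend_eq_centerMass (v : J.pts → ℝ) (hj : dist x j < Ω.bdist j / 8) :
    extend v x = (nbrs j).centerMass (fun i => weight i x) v := by
  have hmem : ∀ i, weight i x ≠ 0 → i ∈ nbrs j := fun i hi =>
    mem_nbrs_of_dist_lt (dist_lt_of_weight_ne_zero hi) hj
  rw [extend, Finset.centerMass, finsum_eq_sum_of_support_subset _ hmem,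
    finsum_eq_sum_of_support_subset _ fun i hi => hmem i (left_ne_zero_of_mul hi)]
  rfl

theorem contDiffOn_extend (v : J.pts → ℝ) : ContDiffOn ℝ 1 (extend v) Ω.carrier := by
  intro x hx
  obtain ⟨j, hj⟩ := J.exists_dist_lt hx
  have hloc : extend v =ᶠ[𝓝 x] fun y => (nbrs j).centerMass (fun i => weight i y) v := by
    filter_upwards [Metric.isOpen_ball.mem_nhds (Metric.mem_ball.2 hj)] with y hy
    exact extend_eq_centerMass v hy
  refine (ContDiffAt.congr_of_eventuallyEq ?_ hloc).contDiffWithinAt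
  have hsum : ContDiff ℝ 1 fun y => ∑ i ∈ nbrs j, weight i y :=
    ContDiff.sum fun i _ => contDiff_weight i
  have hsum' : ContDiff ℝ 1 fun y => ∑ i ∈ nbrs j, weight i y • v i :=
    ContDiff.sum fun i _ => (contDiff_weight i).smul contDiff_const
  exact (hsum.contDiffAt.inv (by linarith [one_le_sum_weight hj])).smul hsum'.contDiffAt

theorem extend_mem_closedBall {c D : ℝ} (hx : x ∈ Ω.carrier)
    (hv : ∀ i : J.pts, dist x i < Ω.bdist i / 8 → v i ∈ Metric.closedBall c D) :
    extend v x ∈ Metric.closedBall c D := by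
  obtain ⟨j, hj⟩ := J.exists_dist_lt hx
  rw [extend_eq_centerMass v hj, ← Finset.centerMass_filter_ne_zero]
  refine (convex_closedBall c D).centerMass_mem (fun i _ => weight_nonneg i x) ?_
    fun i hi => hv i (dist_lt_of_weight_ne_zero (Finset.mem_filter.1 hi).2)
  rw [Finset.sum_filter_ne_zero]
  linarith [one_le_sum_weight hj]

/-- The oscillation of a function on the net over the neighbours of a point. -/
def osc (v : J.pts → ℝ) (j : J.pts) : ℝ :=
  (nbrs j).sup' ⟨j, self_mem_nbrs j⟩ fun i => |v i - v j|

theorem abs_sub_le_osc (v : J.pts → ℝ) (hi : i ∈ nbrs j) : |v i - v j| ≤ osc v j :=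
  Finset.le_sup' (fun i => |v i - v j|) hi

theorem osc_nonneg (v : J.pts → ℝ) (j : J.pts) : 0 ≤ osc v j :=
  (abs_nonneg _).trans (abs_sub_le_osc v (self_mem_nbrs j))

theorem exists_osc_eq (v : J.pts → ℝ) (j : J.pts) : ∃ i ∈ nbrs j, osc v j = |v i - v j| :=
  Finset.exists_mem_eq_sup' _ _

end WhitneyNet

/-- The constant in the gradient estimate for the extension from a Whitney net. -/
def extensionConst (n : ℕ) : ℝ :=
  4 * whitneyBumpLipConst n * 9 ^ n

theorem extensionConst_nonneg (n : ℕ) : 0 ≤ extensionConst n := by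
  unfold extensionConst
  positivity

namespace WhitneyNet

variable {J : Ω.WhitneyNet} {j : J.pts} {x : Fin n → ℝ}

theorem sum_abs_weight_sub_le (j : J.pts) (x y : Fin n → ℝ) :
    ∑ i ∈ nbrs j, |weight i y - weight i x| ≤
      9 ^ n * (2 * whitneyBumpLipConst n / Ω.bdist j * ‖y - x‖) := by
  have hj := J.bdist_pos j
  have hterm : ∀ i ∈ nbrs j, |weight i y - weight i x| ≤
      2 * whitneyBumpLipConst n / Ω.bdist j * ‖y - x‖ := fun i hi => by
    refine (abs_weight_sub_le i x y).trans (mul_le_mul_of_nonneg_right ?_ (norm_nonneg _))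
    rw [div_le_div_iff₀ (J.bdist_pos i) hj, mul_assoc, mul_left_comm]
    exact mul_le_mul_of_nonneg_left (by linarith [le_bdist_of_mem_nbrs hi]) NNReal.zero_le_coe
  refine (Finset.sum_le_card_nsmul _ _ _ hterm).trans ?_
  rw [nsmul_eq_mul]
  exact mul_le_mul_of_nonneg_right (card_nbrs_le j) (by positivity)

theorem norm_fderiv_extend_le (v : J.pts → ℝ) (hx : dist x j ≤ Ω.bdist j / 9) :
    ‖fderiv ℝ (extend v) x‖ ≤ extensionConst n * (osc v j / Ω.bdist j) := by
  have hj := J.bdist_pos j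
  have hosc := osc_nonneg v j
  have hxj : dist x j < Ω.bdist j / 8 := by linarith
  refine norm_fderiv_le_of_lip' ℝ (mul_nonneg (extensionConst_nonneg n) (by positivity)) ?_
  filter_upwards [Metric.isOpen_ball.mem_nhds (Metric.mem_ball.2 hxj)] with y hy
  calc ‖extend v y - extend v x‖
      = ‖(nbrs j).centerMass (fun i => weight i y) v -
          (nbrs j).centerMass (fun i => weight i x) v‖ := by
        rw [extend_eq_centerMass v hy, extend_eq_centerMass v hxj]
    _ ≤ 2 * osc v j * ∑ i ∈ nbrs j, |weight i y - weight i x| :=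
        norm_centerMass_sub_centerMass_le (fun i _ => weight_nonneg i x)
          (by linarith [one_le_sum_weight hxj]) (one_le_sum_weight hy)
          fun i hi => abs_sub_le_osc v hi
    _ ≤ 2 * osc v j * (9 ^ n * (2 * whitneyBumpLipConst n / Ω.bdist j * ‖y - x‖)) :=
        mul_le_mul_of_nonneg_left (sum_abs_weight_sub_le j x y) (by positivity)
    _ = extensionConst n * (osc v j / Ω.bdist j) * ‖y - x‖ := by
        rw [extensionConst]
        ring

end WhitneyNet

end SpaceDomain

theorem eLpNorm_ofReal_eq {X E : Type*} [MeasurableSpace X] [NormedAddCommGroup E] (g : X → E)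
    (μ : Measure X) {p : ℝ} (hp : 0 < p) :
    eLpNorm g (ENNReal.ofReal p) μ = (∫⁻ x, ‖g x‖ₑ ^ p ∂μ) ^ (1 / p) := by
  rw [eLpNorm_eq_lintegral_rpow_enorm_toReal (by simpa using hp) ENNReal.ofReal_ne_top,
    ENNReal.toReal_ofReal hp.le]

namespace SpaceDomain

variable {n : ℕ} {Ω : SpaceDomain n} {α : Ioc (0 : ℝ) 1} {f : Ω.alphaBoundary α → ℝ} {p η lam : ℝ}

theorem VariationBound.sum_le (h : Ω.VariationBound p α η f lam) {ι : Type*} (s : Finset ι)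
    (Q : ι → AxisCube n) (ω₁ ω₂ : ι → Ω.alphaBoundary α) (hQ : ∀ i, (Q i).toSet ⊆ Ω.carrier)
    (hdisj : Pairwise fun i j => Disjoint (Q i).toSet (Q j).toSet)
    (hvis : ∀ i, Ω.IsAlphaVisible α (Q i) (ω₁ i) ∧ Ω.IsAlphaVisible α (Q i) (ω₂ i))
    (hω : ∀ i, Ω.limitPoint α (ω₁ i) ∈ (Q i).dilate η ∩ frontier Ω.carrier ∧
      Ω.limitPoint α (ω₂ i) ∈ (Q i).dilate η ∩ frontier Ω.carrier) :
    ∑ i ∈ s, |f (ω₁ i) - f (ω₂ i)| ^ p / Metric.diam (Q i).toSet ^ (p - n) ≤ lam := by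
  set e := s.equivFin.symm
  have hinj : Function.Injective fun k => (e k : ι) := Subtype.val_injective.comp e.injective
  rw [← Finset.sum_coe_sort s, ← e.sum_comp]
  exact h s.card (fun k => Q (e k)) (fun k => ω₁ (e k)) (fun k => ω₂ (e k)) (fun k => hQ _)
    (hdisj.comp_of_injective hinj) (fun k => hvis _) fun k => hω _

theorem subhypDist_le_bdist_rpow (α : Ioc (0 : ℝ) 1) {x c : Fin n → ℝ}
    (hx : dist x c < Ω.bdist c / 8) : Ω.subhypDist α x c ≤ Ω.bdist c ^ (α : ℝ) := by
  have hd : 0 < Ω.bdist c := by linarith [dist_nonneg (x := x) (y := c)]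
  calc Ω.subhypDist α x c ≤ dist x c * (Ω.bdist c - dist x c) ^ ((α : ℝ) - 1) :=
        subhypDist_le_of_ball_subset α.2.2 (ball_bdist_subset c) (by linarith)
    _ ≤ (Ω.bdist c - dist x c) * (Ω.bdist c - dist x c) ^ ((α : ℝ) - 1) := by
        gcongr
        · exact Real.rpow_nonneg (by linarith) _
        · linarith
    _ = (Ω.bdist c - dist x c) ^ (α : ℝ) := by
        rw [mul_comm, Real.rpow_sub_one (by linarith), div_mul_cancel₀ _ (by linarith)]
    _ ≤ Ω.bdist c ^ (α : ℝ) :=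
        Real.rpow_le_rpow (by linarith) (by linarith [dist_nonneg (x := x) (y := c)]) α.2.1.le

theorem dist_toSubhyp_le {x c : Fin n → ℝ} (hx : x ∈ Ω.carrier) (hc : c ∈ Ω.carrier)
    (hxc : dist x c < Ω.bdist c / 8) :
    dist (toSubhyp α hx) (toSubhyp α hc) ≤ 2 * Ω.bdist c ^ (α : ℝ) := by
  have hnorm : ‖x - c‖ ^ (α : ℝ) ≤ Ω.bdist c ^ (α : ℝ) := by
    rw [← dist_eq_norm]
    exact Real.rpow_le_rpow dist_nonneg (by linarith [dist_nonneg (x := x) (y := c)]) α.2.1.le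
  rw [Subhyp.dist_def, pt_toSubhyp, pt_toSubhyp]
  linarith [subhypDist_le_bdist_rpow α hxc]

namespace WhitneyNet

variable {J : Ω.WhitneyNet} {i j : J.pts} {w : J.pts → Ω.alphaBoundary α}

/-- The cube about a point of the net with half side length one twentieth of the distance to the
complement. -/
def cube (j : J.pts) : AxisCube n :=
  ⟨j, Ω.bdist j / 20, div_pos (J.bdist_pos j) (by norm_num)⟩

theorem cube_subset (j : J.pts) : (cube j).toSet ⊆ Ω.carrier := by
  refine (Metric.closedBall_subset_ball ?_).trans (ball_bdist_subset (j : Fin n → ℝ))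
  exact div_lt_self (J.bdist_pos j) (by norm_num)

theorem pairwise_disjoint_cube :
    Pairwise fun i j : J.pts => Disjoint (cube i).toSet (cube j).toSet :=
  fun _ _ hij => Metric.closedBall_disjoint_closedBall
    ((add_div _ _ _).symm.trans_lt (lt_dist_of_ne hij))

theorem isAlphaVisible_cube
    (hvis : ∀ (j : J.pts) (Q : AxisCube n), Q.toSet ⊆ Metric.ball (j : Fin n → ℝ) (Ω.bdist j) →
      Ω.IsAlphaVisible α Q (w j)) (hi : i ∈ nbrs j) : Ω.IsAlphaVisible α (cube j) (w i) := by
  refine hvis i _ (Metric.closedBall_subset_ball' ?_)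
  change Ω.bdist j / 20 + dist (j : Fin n → ℝ) i < Ω.bdist i
  linarith [mem_nbrs.1 hi, le_bdist_of_mem_nbrs hi, J.bdist_pos j, dist_comm (i : Fin n → ℝ) j]

theorem limitPoint_mem_dilate_cube (hη : 32 ≤ η)
    (hlim : ∀ j : J.pts, dist (j : Fin n → ℝ) (Ω.limitPoint α (w j)) = Ω.bdist j)
    (hi : i ∈ nbrs j) :
    Ω.limitPoint α (w i) ∈ (cube j).dilate η := by
  change dist (Ω.limitPoint α (w i)) j ≤ η * (Ω.bdist j / 20)
  have hηj : 32 * (Ω.bdist j / 20) ≤ η * (Ω.bdist j / 20) :=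
    mul_le_mul_of_nonneg_right hη (by linarith [J.bdist_pos j])
  linarith [dist_triangle_left (Ω.limitPoint α (w i)) j i, hlim i, mem_nbrs.1 hi,
    bdist_le_of_mem_nbrs hi, J.bdist_pos j]

theorem sum_osc_rpow_le (hn : 1 ≤ n) (hη : 32 ≤ η)
    (hlim : ∀ j : J.pts, dist (j : Fin n → ℝ) (Ω.limitPoint α (w j)) = Ω.bdist j)
    (hvis : ∀ (j : J.pts) (Q : AxisCube n), Q.toSet ⊆ Metric.ball (j : Fin n → ℝ) (Ω.bdist j) →
      Ω.IsAlphaVisible α Q (w j))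
    (h : Ω.VariationBound p α η f lam) (s : Finset J.pts) :
    ∑ j ∈ s, osc (f ∘ w) j ^ p / (2 * (Ω.bdist j / 20)) ^ (p - n) ≤ lam := by
  have : Nonempty (Fin n) := ⟨⟨0, hn⟩⟩
  have hdiam : ∀ j : J.pts, Metric.diam (cube j).toSet = 2 * (Ω.bdist j / 20) := fun j =>
    Metric.diam_closedBall_eq _ (cube j).radius_pos.le
  have hmem : ∀ j, ∀ i ∈ nbrs j,
      Ω.limitPoint α (w i) ∈ (cube j).dilate η ∩ frontier Ω.carrier := fun j i hi =>
    ⟨limitPoint_mem_dilate_cube hη hlim hi, mem_alphaBoundary_iff.1 (w i).2⟩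
  have hvis' : ∀ j, ∀ i ∈ nbrs j, Ω.IsAlphaVisible α (cube j) (w i) := fun j i hi =>
    isAlphaVisible_cube hvis hi
  choose k hk hosc using exists_osc_eq (f ∘ w)
  simp only [hosc, ← hdiam, Function.comp_apply]
  exact h.sum_le s cube (w ∘ k) w cube_subset pairwise_disjoint_cube
    (fun j => ⟨hvis' j _ (hk j), hvis' j j (self_mem_nbrs j)⟩)
    fun j => ⟨hmem j _ (hk j), hmem j j (self_mem_nbrs j)⟩

theorem isTrace_extend (hf : Ω.IsSubhypContinuous α f) {A : ℝ} (hA : 0 ≤ A)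
    (hw : ∀ j : J.pts, dist (toSubhyp α (mem_carrier j) : Ω.SubhypCompletion α) (w j) ≤
      A * Ω.bdist j ^ (α : ℝ)) :
    Ω.IsTrace α (extend (f ∘ w)) f := by
  intro ω
  refine Metric.tendsto_nhds.2 fun ε hε => ?_
  obtain ⟨δ, hδ, hfδ⟩ := hf ω (ε / 2) (half_pos hε)
  let bound : Ω.SubhypCompletion α → ℝ := fun ζ => dist (ω : Ω.SubhypCompletion α) ζ +
    (A + 2) * (2 * dist (Ω.limitPoint α ζ) (Ω.limitPoint α ω)) ^ (α : ℝ)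
  have hbound : Tendsto bound (𝓝 ω) (𝓝 0) := by
    have hcont : Continuous bound := (continuous_const.dist continuous_id).add
      (continuous_const.mul ((continuous_const.mul
        (continuous_limitPoint.dist continuous_const)).rpow_const fun _ => Or.inr α.2.1.le))
    simpa [bound, Real.zero_rpow α.2.1.ne'] using hcont.tendsto (ω : Ω.SubhypCompletion α)
  filter_upwards [(hbound.comp tendsto_comap).eventually_lt_const hδ] with x hx
  refine (extend_mem_closedBall x.pt_mem fun i hi => ?_ : _ ≤ ε / 2).trans_lt (half_lt_self hε)
  have hbdist : Ω.bdist i ≤ 2 * dist x.pt (Ω.limitPoint α ω) := by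
    linarith [Ω.bdist_le_add_dist i x.pt, dist_comm (i : Fin n → ℝ) x.pt, J.bdist_pos i,
      bdist_le_dist_of_mem_frontier (mem_alphaBoundary_iff.1 ω.2) x.pt]
  have hxw : dist (x : Ω.SubhypCompletion α) (w i) ≤ (A + 2) * Ω.bdist i ^ (α : ℝ) := by
    have hxi := dist_toSubhyp_le (α := α) x.pt_mem (mem_carrier i) hi
    rw [← Completion.dist_eq] at hxi
    exact (dist_triangle _ _ _).trans ((add_le_add hxi (hw i)).trans_eq (by ring))
  refine (hfδ (w i) ?_).le
  calc Ω.closureDist α ω (w i) ≤ dist (ω : Ω.SubhypCompletion α) (w i) := closureDist_le_dist _ _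
    _ ≤ dist (ω : Ω.SubhypCompletion α) x + dist (x : Ω.SubhypCompletion α) (w i) :=
        dist_triangle _ _ _
    _ ≤ bound x := by
        refine add_le_add_right (hxw.trans (mul_le_mul_of_nonneg_left ?_ (by linarith))) _
        rw [limitPoint_coe]
        exact Real.rpow_le_rpow (J.bdist_pos i).le hbdist α.2.1.le
    _ < δ := hx

theorem setLIntegral_coordGradient_extend_le (hp : n < p) (v : J.pts → ℝ) (j : J.pts) :
    ∫⁻ x in Metric.closedBall (j : Fin n → ℝ) (Ω.bdist j / 9),
        ‖coordGradient (extend v) x‖ₑ ^ p ≤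
      ENNReal.ofReal
        (extensionConst n ^ p * (osc v j ^ p / (2 * (Ω.bdist j / 20)) ^ (p - n))) := by
  have hp0 : 0 < p := n.cast_nonneg.trans_lt hp
  have hj := J.bdist_pos j
  have hosc := osc_nonneg v j
  have hC := extensionConst_nonneg n
  set d := Ω.bdist j
  have hgradient : ∀ x ∈ Metric.closedBall (j : Fin n → ℝ) (d / 9),
      ‖coordGradient (extend v) x‖ₑ ^ p ≤
        ENNReal.ofReal ((extensionConst n * (osc v j / d)) ^ p) := fun x hx => by
    rw [← ENNReal.ofReal_rpow_of_nonneg (by positivity) hp0.le, ← ofReal_norm]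
    gcongr
    exact (norm_coordGradient_le _ x).trans (norm_fderiv_extend_le v hx)
  refine (setLIntegral_mono' measurableSet_closedBall hgradient).trans ?_
  rw [setLIntegral_const, Real.volume_pi_closedBall _ (by positivity), Fintype.card_fin,
    ← ENNReal.ofReal_mul (by positivity)]
  refine ENNReal.ofReal_le_ofReal ?_
  calc (extensionConst n * (osc v j / d)) ^ p * (2 * (d / 9)) ^ n
      ≤ (extensionConst n * (osc v j / d)) ^ p * d ^ n := by
        gcongr
        linarith
    _ = extensionConst n ^ p * (osc v j ^ p / d ^ (p - n)) := by
        rw [Real.mul_rpow hC (by positivity), Real.div_rpow hosc hj.le, Real.rpow_sub hj,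
          Real.rpow_natCast]
        field_simp
    _ ≤ extensionConst n ^ p * (osc v j ^ p / (2 * (d / 20)) ^ (p - n)) := by
        have : 0 ≤ p - n := by linarith
        gcongr
        linarith

theorem setLIntegral_coordGradient_extend_le_of_sum_le (hp : n < p) {v : J.pts → ℝ}
    (hv : ∀ s : Finset J.pts, ∑ j ∈ s, osc v j ^ p / (2 * (Ω.bdist j / 20)) ^ (p - n) ≤ lam) :
    ∫⁻ x in Ω.carrier, ‖coordGradient (extend v) x‖ₑ ^ p ≤
      ENNReal.ofReal (extensionConst n ^ p * lam) := by
  have := J.countable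
  have hC := extensionConst_nonneg n
  have hcover : Ω.carrier ⊆ ⋃ j : J.pts, Metric.closedBall (j : Fin n → ℝ) (Ω.bdist j / 9) :=
    fun x hx => mem_iUnion.2 (J.cover x hx)
  refine (lintegral_mono_set hcover).trans ((lintegral_iUnion_le _ _).trans
    ((ENNReal.tsum_le_tsum (setLIntegral_coordGradient_extend_le hp v)).trans ?_))
  rw [ENNReal.tsum_eq_iSup_sum]
  refine iSup_le fun s => ?_
  rw [← ENNReal.ofReal_sum_of_nonneg fun j _ => ?_, ← Finset.mul_sum]
  · exact ENNReal.ofReal_le_ofReal (mul_le_mul_of_nonneg_left (hv s) (by positivity))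
  · have := J.bdist_pos j
    have := osc_nonneg v j
    positivity

end WhitneyNet

theorem isSobolevWith_coordGradient {F : (Fin n → ℝ) → ℝ} (hp : 0 < p)
    (hF : ContDiffOn ℝ 1 F Ω.carrier)
    (henergy : ∫⁻ x in Ω.carrier, ‖coordGradient F x‖ₑ ^ p ≠ ⊤) :
    Ω.IsSobolevWith p F (coordGradient F) where
  continuousOn := hF.continuousOn
  isWeakGradient := isWeakGradient_of_contDiffOn hF
  memLp := ⟨(measurable_coordGradient F).aestronglyMeasurable, by
    rw [eLpNorm_ofReal_eq _ _ hp]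
    exact ENNReal.rpow_lt_top_of_nonneg (by positivity) henergy⟩

theorem exists_extension_of_nonempty_compl (hn : 1 ≤ n) (hp : n < p) (hη : 32 ≤ η)
    (hne : Ω.carrierᶜ.Nonempty) (hf : Ω.IsSubhypContinuous α f)
    (hlam : Ω.VariationBound p α η f lam) :
    ∃ F g, Ω.IsSobolevWith p F g ∧ Ω.IsTrace α F f ∧
      ∫⁻ x in Ω.carrier, ‖g x‖ₑ ^ p ≤ ENNReal.ofReal (extensionConst n ^ p * lam) := by
  obtain ⟨J⟩ := nonempty_whitneyNet hne
  choose w hlim hdist hvis using fun j : J.pts =>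
    exists_nearest_boundary_element α hne (WhitneyNet.mem_carrier j)
  have henergy := WhitneyNet.setLIntegral_coordGradient_extend_le_of_sum_le hp
    (WhitneyNet.sum_osc_rpow_le hn hη hlim hvis hlam)
  have hα : 0 ≤ 1 / (α : ℝ) + 1 := by linarith [one_div_pos.2 α.2.1]
  exact ⟨_, _, isSobolevWith_coordGradient (n.cast_nonneg.trans_lt hp)
    (WhitneyNet.contDiffOn_extend _) (ne_top_of_le_ne_top ENNReal.ofReal_ne_top henergy),
    WhitneyNet.isTrace_extend hf hα hdist, henergy⟩

theorem exists_extension (hn : 1 ≤ n) (hp : n < p) (hη : 32 ≤ η) (hlam0 : 0 ≤ lam)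
    (hf : Ω.IsSubhypContinuous α f) (hlam : Ω.VariationBound p α η f lam) :
    ∃ F g, Ω.IsSobolevWith p F g ∧ Ω.IsTrace α F f ∧
      (eLpNorm g (ENNReal.ofReal p) (volume.restrict Ω.carrier)).toReal ≤
        extensionConst n * lam ^ (1 / p) := by
  have hp0 : 0 < p := n.cast_nonneg.trans_lt hp
  have hC := extensionConst_nonneg n
  rcases Ω.carrierᶜ.eq_empty_or_nonempty with hempty | hne
  · have hfrontier : frontier Ω.carrier = ∅ := by rw [compl_empty_iff.1 hempty, frontier_univ]
    refine ⟨0, 0, ⟨continuousOn_const, fun φ _ _ _ i => by simp, MemLp.zero⟩, fun ω => ?_, ?_⟩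
    · exact absurd (mem_alphaBoundary_iff.1 ω.2) (hfrontier ▸ notMem_empty _)
    · rw [eLpNorm_zero, ENNReal.toReal_zero]
      positivity
  · obtain ⟨F, g, hg, hF, henergy⟩ := exists_extension_of_nonempty_compl hn hp hη hne hf hlam
    refine ⟨F, g, hg, hF, ENNReal.toReal_le_of_le_ofReal (by positivity) ?_⟩
    rw [eLpNorm_ofReal_eq _ _ hp0]
    refine (ENNReal.rpow_le_rpow henergy (by positivity)).trans_eq ?_
    rw [ENNReal.ofReal_rpow_of_nonneg (by positivity) (by positivity),
      Real.mul_rpow (by positivity) hlam0, ← Real.rpow_mul hC, mul_one_div_cancel hp0.ne',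
      Real.rpow_one]

end SpaceDomain

/-! ### Comparison of the norms -/

namespace SpaceDomain

variable {n : ℕ} {Ω : SpaceDomain n} {α : Ioc (0 : ℝ) 1} {f : Ω.alphaBoundary α → ℝ} {p η lam : ℝ}

/-- The variational norm of a function on the `α`-boundary: the infimum of `λ ^ (1 / p)` over the
`λ > 0` for which the variational inequality holds. It is `0` when there is no such `λ`. -/
def variationNorm (Ω : SpaceDomain n) (p : ℝ) (α : Ioc (0 : ℝ) 1) (η : ℝ)
    (f : Ω.alphaBoundary α → ℝ) : ℝ :=
  sInf {t : ℝ | ∃ lam : ℝ, 0 < lam ∧ Ω.VariationBound p α η f lam ∧ t = lam ^ (1 / p)}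

theorem traceNorm_nonneg : 0 ≤ Ω.traceNorm p α f :=
  Real.sInf_nonneg fun _ ⟨_, _, _, _, hN⟩ => hN ▸ ENNReal.toReal_nonneg

theorem variationNorm_nonneg : 0 ≤ Ω.variationNorm p α η f :=
  Real.sInf_nonneg fun _ ⟨_, hlam0, _, ht⟩ => ht ▸ Real.rpow_nonneg hlam0.le _

theorem VariationBound.mono {lam' : ℝ} (h : Ω.VariationBound p α η f lam) (hle : lam ≤ lam') :
    Ω.VariationBound p α η f lam' :=
  fun m Q ω₁ ω₂ hQ hdisj hvis hω => (h m Q ω₁ ω₂ hQ hdisj hvis hω).trans hle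

theorem variationNorm_le (hp : 0 < p) (hlam0 : 0 ≤ lam) (h : Ω.VariationBound p α η f lam) :
    Ω.variationNorm p α η f ≤ lam ^ (1 / p) := by
  have hbdd : BddBelow {t : ℝ | ∃ lam : ℝ, 0 < lam ∧ Ω.VariationBound p α η f lam ∧
      t = lam ^ (1 / p)} := ⟨0, by
    rintro _ ⟨lam', hlam', -, rfl⟩
    positivity⟩
  have hlarger : ∀ lam' > lam, Ω.variationNorm p α η f ≤ lam' ^ (1 / p) := fun lam' hlt =>
    csInf_le hbdd ⟨lam', hlam0.trans_lt hlt, h.mono hlt.le, rfl⟩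
  have hcont : ContinuousAt (fun t : ℝ => t ^ (1 / p)) lam :=
    Real.continuousAt_rpow_const _ _ (Or.inr (by positivity))
  exact ge_of_tendsto (hcont.tendsto.mono_left (nhdsWithin_le_nhds (s := Ioi lam)))
    (eventually_mem_nhdsWithin.mono hlarger)

theorem IsTrace.exists_variationBound {F : (Fin n → ℝ) → ℝ} {g : (Fin n → ℝ) → Fin n → ℝ}
    (hF : Ω.IsTrace α F f) (h : Ω.IsSobolevWith p F g) (hn : 1 ≤ n) (hp : n < p) (hη : 1 ≤ η) :
    ∃ lam, 0 ≤ lam ∧ Ω.VariationBound p α η f lam ∧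
      lam ^ (1 / p) = (variationConst n p η).toReal ^ (1 / p) *
        (eLpNorm g (ENNReal.ofReal p) (volume.restrict Ω.carrier)).toReal := by
  have hp0 : 0 < p := n.cast_nonneg.trans_lt hp
  refine ⟨_, ENNReal.toReal_nonneg, hF.variationBound h hn hp hη ENNReal.toReal_nonneg
    (ENNReal.ofReal_toReal (ENNReal.mul_ne_top (variationConst_ne_top hp0 hp hη)
      (h.setLIntegral_ne_top hp0))).ge, ?_⟩
  rw [ENNReal.toReal_mul, Real.mul_rpow ENNReal.toReal_nonneg ENNReal.toReal_nonneg,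
    eLpNorm_ofReal_eq _ _ hp0, ← ENNReal.toReal_rpow]

theorem variationNorm_le_mul_traceNorm (hn : 1 ≤ n) (hp : n < p) (hη : 1 ≤ η)
    (hf : Ω.IsSobolevTrace p α f) :
    Ω.variationNorm p α η f ≤
      (variationConst n p η).toReal ^ (1 / p) * Ω.traceNorm p α f := by
  obtain ⟨F₀, g₀, hg₀, hF₀⟩ := hf
  rw [traceNorm, ← smul_eq_mul, ← Real.sInf_smul_of_nonneg (by positivity)]
  refine le_csInf ⟨_, _, ⟨F₀, g₀, hg₀, hF₀, rfl⟩, rfl⟩ ?_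
  rintro _ ⟨_, ⟨F, g, hg, hF, rfl⟩, rfl⟩
  obtain ⟨lam, hlam0, hlam, heq⟩ := hF.exists_variationBound hg hn hp hη
  exact (variationNorm_le (n.cast_nonneg.trans_lt hp) hlam0 hlam).trans_eq heq

theorem traceNorm_le_mul_variationNorm (hn : 1 ≤ n) (hp : n < p) (hη : 32 ≤ η)
    (hf : Ω.IsSubhypContinuous α f) (hlam0 : 0 < lam) (hlam : Ω.VariationBound p α η f lam) :
    Ω.traceNorm p α f ≤ extensionConst n * Ω.variationNorm p α η f := by
  have hbdd : BddBelow {N : ℝ | ∃ F g, Ω.IsSobolevWith p F g ∧ Ω.IsTrace α F f ∧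
      N = (eLpNorm g (ENNReal.ofReal p) (volume.restrict Ω.carrier)).toReal} := ⟨0, by
    rintro _ ⟨F, g, -, -, rfl⟩
    exact ENNReal.toReal_nonneg⟩
  rw [variationNorm, ← smul_eq_mul, ← Real.sInf_smul_of_nonneg (extensionConst_nonneg n)]
  refine le_csInf ⟨_, _, ⟨lam, hlam0, hlam, rfl⟩, rfl⟩ ?_
  rintro _ ⟨_, ⟨lam', hlam0', hlam', rfl⟩, rfl⟩
  obtain ⟨F, g, hg, hF, hle⟩ := exists_extension hn hp hη hlam0'.le hf hlam'
  exact (csInf_le hbdd ⟨F, g, hg, hF, rfl⟩).trans hle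

theorem isSobolevTrace_iff (hn : 1 ≤ n) (hp : n < p) (hη : 32 ≤ η) :
    Ω.IsSobolevTrace p α f ↔
      Ω.IsSubhypContinuous α f ∧ ∃ lam : ℝ, 0 < lam ∧ Ω.VariationBound p α η f lam := by
  constructor
  · rintro ⟨F, g, hg, hF⟩
    obtain ⟨lam, hlam0, hlam, -⟩ := hF.exists_variationBound hg hn hp (by linarith)
    exact ⟨hF.isSubhypContinuous, lam + 1, by positivity, hlam.mono (by linarith)⟩
  · rintro ⟨hf, lam, hlam0, hlam⟩
    obtain ⟨F, g, hg, hF, -⟩ := exists_extension hn hp hη hlam0.le hf hlam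
    exact ⟨F, g, hg, hF⟩

end SpaceDomain

end

theorem theorem5p1_general {n : ℕ} (hn : 1 ≤ n) {p : ℝ} (hp : n < p) (α : Ioc (0 : ℝ) 1) {η : ℝ}
    (hη : 32 ≤ η) :
    ∃ C : ℝ, 1 ≤ C ∧ ∀ (Ω : SpaceDomain n) (f : Ω.alphaBoundary α → ℝ),
      (Ω.IsSobolevTrace p α f ↔
        Ω.IsSubhypContinuous α f ∧ ∃ lam : ℝ, 0 < lam ∧ Ω.VariationBound p α η f lam) ∧
      (Ω.IsSobolevTrace p α f →
        C⁻¹ * Ω.variationNorm p α η f ≤ Ω.traceNorm p α f ∧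
        Ω.traceNorm p α f ≤ C * Ω.variationNorm p α η f) := by
  set A := (SpaceDomain.variationConst n p η).toReal ^ (1 / p) with hA
  set B := SpaceDomain.extensionConst n with hB
  have hC : 1 ≤ max 1 (max A B) := le_max_left _ _
  refine ⟨max 1 (max A B), hC, fun Ω f =>
    ⟨SpaceDomain.isSobolevTrace_iff hn hp hη, fun htrace => ?_⟩⟩
  obtain ⟨hf, lam, hlam0, hlam⟩ := (SpaceDomain.isSobolevTrace_iff hn hp hη).1 htrace
  rw [inv_mul_le_iff₀ (by positivity)]
  constructor
  · refine (SpaceDomain.variationNorm_le_mul_traceNorm hn hp (by linarith) htrace).trans ?_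
    exact mul_le_mul_of_nonneg_right (by simp [hA]) SpaceDomain.traceNorm_nonneg
  · refine (SpaceDomain.traceNorm_le_mul_variationNorm hn hp hη hf hlam0 hlam).trans ?_
    exact mul_le_mul_of_nonneg_right (by simp [hB]) SpaceDomain.variationNorm_nonneg

theorem theorem5p1 (n : ℕ) (hn : 1 ≤ n) (p : ℝ) (hp : (n : ℝ) < p)
    (α : Set.Ioc (0 : ℝ) 1) (hα : (α : ℝ) = (p - n) / (p - 1)) (η : ℝ) (hη : 41 ≤ η) :
    ∃ C : ℝ, 1 ≤ C ∧ ∀ (Ω : SpaceDomain n) (f : Ω.alphaBoundary α → ℝ),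
      (Ω.IsSobolevTrace p α f ↔
        Ω.IsSubhypContinuous α f ∧ ∃ lam : ℝ, 0 < lam ∧ Ω.VariationBound p α η f lam) ∧
      (Ω.IsSobolevTrace p α f →
        C⁻¹ * sInf {t : ℝ | ∃ lam : ℝ, 0 < lam ∧ Ω.VariationBound p α η f lam ∧
            t = lam ^ (1 / p)} ≤ Ω.traceNorm p α f ∧
        Ω.traceNorm p α f ≤ C * sInf {t : ℝ | ∃ lam : ℝ, 0 < lam ∧
            Ω.VariationBound p α η f lam ∧ t = lam ^ (1 / p)}) :=
  theorem5p1_general hn hp α (by linarith)
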